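/- Let $d>3$ be odd, $t=\lfloor (d-1)/2\rfloor$ and $n=d^2+(d-1)^2$. **Code.** The $[[n,1,d]]$ ZZZY surface code has data qubits $q_{i,j}$ ($0\le i,j\le d-1$), the $d$ qubits $q_{i,0},\dots,q_{i,d-1}$ forming lattice row $i$, and $r_{i,c}$ ($0\le i,c\le d-2$), lying between rows $i$ and $i+1$. Its generators are the $X$ generators $A_{i,c}$ ($0\le i\le d-1$, $0\le c\le d-2$), measuring $X$ on $q_{i,c},q_{i,c+1},r_{i-1,c},r_{i,c}$, and generators $B_{i,j}$ ($0\le i\le d-2$, $0\le j\le d-1$), measuring $Z$ on $q_{i,j},q_{i+1,j},r_{i,j-1},r_{i,j}$ (nonexistent qubits omitted), except that they measure $Y$ instead of $Z$ on the qubits $q_{i,0},q_{i,d-1}$ with $i$ even and $q_{i,1},q_{i,d-2}$ with $i$ odd. The $B_{i,j}$ containing a $Y$ are the ZY generators. The syndrome $s$ of a Pauli error records for each generator (ancilla) whether it anticommutes with the error (switched on, value $1$) or commutes with it (value $0$). **MWPM.** Let weights on the data qubits be given, and consider the set of switched-on ancillas of one type ($X$ generators, or $B$ generators). A perfect matching pairs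 each of them with another one or with the lattice boundary; the partners of each pair are connected by a chain of data qubits, i.e. a set of qubits such that the ancillas of that type touching an odd number of its elements are exactly the one or two ancillas of the pair, and no qubit is used by two different chains. MWPM returns the set of data qubits used by a matching of minimum total weight, with an arbitrary choice in case of ties. **Decoder.** On input $s$ the ZZZY decoder proceeds as follows. 1. (`update_weights`) All qubits get weight $1$. Then each ZY generator in turn, row by row, sets the weight of the qubit on which it measures $Y$ to $0.9$ if it is switched on and to $1.1$ if it is switched off. Finally, if a ZY generator is switched on and no $X$ generator lying in the lattice rows directly above and below its $Y$-measured qubit is switched on, the weight of that qubit is set to $-0.1$. 2. MWPM with these weights on the switched-on $X$ generators gives the set $\hat z$ of estimated $Z$ errors. 3. (Syndrome flipping) For every qubit of $\hat z$, the syndrome bits of all generators measuring $Y$ on it are inverted. 4. MWPM with the same weights on the $B$ generators that are now switched on gives the set $\hat x$ of estimated $X$ errors. An error is corrected if its product with the estimate $Z_{\hat z}X_{\hat x}$ is, up to phase, in the stabilizer group. **Claim.** Such decoders exist, and for each of them (whatever the choices in case of ties) the fraction of the weight-$(t+1)$ $Z$ error patterns (the weight-$(t+1)$ errors of a phase-flip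 channel) that are not corrected is exactly $$\frac{d\binom{d-2}{t+1}}{\binom{n}{t+1}}.$$ The uncorrected patterns of weight $t+1$ are exactly those contained in a single lattice row and avoiding the two qubits of that row on which a $Y$ measurement is performed. -/

import Mathlib

namespace ZZZY

/-! ### The lattice -/

/-- Data qubits of the (non-rotated, planar) surface code of distance `d`.
`Sum.inl (i, j)` is the qubit `q_{i,j}` in column `j` of the `i`-th lattice row of `d` qubits;
`Sum.inr (i, c)` is the qubit in position `c` of the intermediate row of `d - 1` qubits
between lattice rows `i` and `i + 1`. -/
abbrev Qubit (d : ℕ) : Type := (Fin d × Fin d) ⊕ (Fin (d - 1) × Fin (d - 1))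

/-- `X` ancillas: `(i, c)` sits in lattice row `i`, between `q_{i,c}` and `q_{i,c+1}`. -/
abbrev XAnc (d : ℕ) : Type := Fin d × Fin (d - 1)

/-- `Z` ancillas: `(i, j)` sits between `q_{i,j}` and `q_{i+1,j}`. -/
abbrev ZAnc (d : ℕ) : Type := Fin (d - 1) × Fin d

/-- All ancillas, equivalently all stabilizer generators. -/
abbrev Anc (d : ℕ) : Type := XAnc d ⊕ ZAnc d

/-- The data qubits next to an `X` ancilla. -/
def XAnc.Touches {d : ℕ} (a : XAnc d) : Qubit d → Prop
  | Sum.inl (i, j) => i = a.1 ∧ (j.val = a.2.val ∨ j.val = a.2.val + 1)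
  | Sum.inr (i, c) => c = a.2 ∧ (i.val = a.1.val ∨ i.val + 1 = a.1.val)

/-- The data qubits next to a `Z` ancilla. -/
def ZAnc.Touches {d : ℕ} (a : ZAnc d) : Qubit d → Prop
  | Sum.inl (i, j) => j = a.2 ∧ (i.val = a.1.val ∨ i.val = a.1.val + 1)
  | Sum.inr (i, c) => i = a.1 ∧ (c.val = a.2.val ∨ c.val + 1 = a.2.val)

instance {d : ℕ} (a : XAnc d) : DecidablePred a.Touches := fun q => by
  rcases q with ⟨i, j⟩ | ⟨i, c⟩ <;> unfold XAnc.Touches <;> infer_instance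

instance {d : ℕ} (a : ZAnc d) : DecidablePred a.Touches := fun q => by
  rcases q with ⟨i, j⟩ | ⟨i, c⟩ <;> unfold ZAnc.Touches <;> infer_instance

/-- The qubits whose `Z` measurements are replaced by `Y` measurements: `q_{2l,0}`, `q_{2l,d-1}`,
`q_{2l+1,1}` and `q_{2l+1,d-2}`. -/
def Modified {d : ℕ} : Qubit d → Prop
  | Sum.inl (i, j) =>
      (i.val % 2 = 0 ∧ (j.val = 0 ∨ j.val + 1 = d)) ∨
      (i.val % 2 = 1 ∧ (j.val = 1 ∨ j.val + 2 = d))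
  | Sum.inr _ => False

instance {d : ℕ} : DecidablePred (Modified (d := d)) := fun q => by
  rcases q with ⟨i, j⟩ | ⟨i, c⟩ <;> unfold Modified <;> infer_instance

/-! ### Pauli operators, generators, syndromes -/

/-- Pauli operators up to phase in binary form: a `Z` part and an `X` part
(`Y` has both entries equal to `1`). -/
abbrev Pauli (d : ℕ) : Type := (Qubit d → ZMod 2) × (Qubit d → ZMod 2)

/-- The generators, i.e. the rows of `H`. An `X` generator measures `X` on the qubits it touches.
The other generators measure `Z` on the qubits they touch, except `Y` on the modified ones. -/
def gen (d : ℕ) : Anc d → Pauli d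
  | Sum.inl a => (0, fun q => if a.Touches q then 1 else 0)
  | Sum.inr a =>
      (fun q => if a.Touches q then 1 else 0,
       fun q => if a.Touches q ∧ Modified q then 1 else 0)

/-- The symplectic form: `0` if the two operators commute, `1` if they anticommute. -/
def symp {d : ℕ} (p p' : Pauli d) : ZMod 2 := ∑ q, (p.1 q * p'.2 q + p.2 q * p'.1 q)

/-- A syndrome: the outcomes of all ancillas. -/
abbrev Syndrome (d : ℕ) : Type := Anc d → ZMod 2

/-- The syndrome of an error operator. -/
def syndrome {d : ℕ} (E : Pauli d) : Syndrome d := fun a => symp (gen d a) E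

/-- The stabilizer group, up to phases. -/
def stabilizer (d : ℕ) : Submodule (ZMod 2) (Pauli d) :=
  Submodule.span (ZMod 2) (Set.range (gen d))

/-- The `0`-`1` vector of a set of qubits. -/
def ind {d : ℕ} (e : Finset (Qubit d)) : Qubit d → ZMod 2 := fun q => if q ∈ e then 1 else 0

/-- The operator with a `Z` on each qubit of `z` and an `X` on each qubit of `x`. -/
def toPauli {d : ℕ} (z x : Finset (Qubit d)) : Pauli d := (ind z, ind x)

/-- Generator `a` performs a `Y` measurement on the qubit `q`
(`H(a,q) = 1` and `H(a,q+n) = 1`). -/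
def MeasuresY {d : ℕ} (a : Anc d) (q : Qubit d) : Prop := (gen d a).1 q = 1 ∧ (gen d a).2 q = 1

instance {d : ℕ} (a : Anc d) (q : Qubit d) : Decidable (MeasuresY a q) := by
  unfold MeasuresY; infer_instance

/-! ### The weights -/

/-- The `ZY` generators, listed row by row. -/
def zyList (d : ℕ) : List (Anc d) :=
  ((List.finRange (d - 1)).flatMap fun i => (List.finRange d).map fun j =>
    (Sum.inr (i, j) : Anc d)).filter fun a => decide (∃ q, MeasuresY a q)

/-- The `X` ancilla `a` lies in the lattice row directly above or directly below the qubit. -/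
def AdjacentRow {d : ℕ} (a : XAnc d) : Qubit d → Prop
  | Sum.inl (i, _) => a.1.val + 1 = i.val ∨ a.1.val = i.val + 1
  | Sum.inr (i, _) => a.1.val = i.val ∨ a.1.val = i.val + 1

instance {d : ℕ} (a : XAnc d) : DecidablePred (AdjacentRow a) := fun q => by
  rcases q with ⟨i, j⟩ | ⟨i, c⟩ <;> unfold AdjacentRow <;> infer_instance

/-- First loop of the weight update: starting from all ones, every `ZY` generator in turn sets the
weight of the qubit on which it measures `Y` to `0.9` if it is switched on, to `1.1` if it is
switched off. -/
def firstWeights {d : ℕ} (s : Syndrome d) : Qubit d → ℚ :=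
  (zyList d).foldl
    (fun w a q => if MeasuresY a q then (if s a = 1 then 9 / 10 else 11 / 10) else w q)
    (fun _ => 1)

/-- The set `𝒜`: the switched-on generators measuring `Y` on a qubit such that no `X` ancilla in
the lattice rows above and below that qubit is switched on. -/
def InA {d : ℕ} (s : Syndrome d) (a : Anc d) : Prop :=
  s a = 1 ∧ ∃ q, MeasuresY a q ∧ ∀ b : XAnc d, AdjacentRow b q → s (Sum.inl b) = 0

instance {d : ℕ} (s : Syndrome d) : DecidablePred (InA s) := fun a => by
  unfold InA; infer_instance

/-- The outcome of `update_weights`: the qubits on which a generator of `𝒜` measures `Y` finally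
get the weight `-0.1`. -/
def updateWeights {d : ℕ} (s : Syndrome d) (q : Qubit d) : ℚ :=
  if ∃ a, InA s a ∧ MeasuresY a q then -1 / 10 else firstWeights s q

/-! ### Minimum weight perfect matching -/

section Matching

variable {V Q : Type} [Fintype V] [DecidableEq V] [Fintype Q] [DecidableEq Q]

/-- The ancillas that touch an odd number of elements of the chain `C` of data qubits: the
endpoints of `C`, other than those on the boundary of the lattice. -/
def endpoints (T : V → Q → Prop) [∀ v, DecidablePred (T v)] (C : Finset Q) : Finset V :=
  Finset.univ.filter fun v => Odd (C.filter (T v)).card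

/-- `E` is the set of qubits used by a perfect matching of the switched-on ancillas `S`. The
ancillas of `S` are divided into blocks `B` of two ancillas (matched with each other) or of one
ancilla (matched with the boundary of the lattice); the chain `c B` of data qubits connects the two
ancillas, respectively the ancilla and the boundary; no qubit is used by two different chains. -/
def IsMatching (T : V → Q → Prop) [∀ v, DecidablePred (T v)] (S : Finset V) (E : Finset Q) :
    Prop :=
  ∃ (P : Finpartition S) (c : Finset V → Finset Q),
    (∀ B ∈ P.parts, B.card ≤ 2 ∧ endpoints T (c B) = B) ∧
    (P.parts : Set (Finset V)).PairwiseDisjoint c ∧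
    E = P.parts.biUnion c

/-- `E` is the set of qubits used by a perfect matching of `S` of minimum weight. -/
def IsMWPM (T : V → Q → Prop) [∀ v, DecidablePred (T v)] (w : Q → ℚ) (S : Finset V)
    (E : Finset Q) : Prop :=
  IsMatching T S E ∧ ∀ E', IsMatching T S E' → ∑ q ∈ E, w q ≤ ∑ q ∈ E', w q

end Matching

/-! ### The decoder -/

/-- The syndrome after inverting, for each estimated `Z` error, all ancillas measuring `Y` on the
respective qubit. -/
def flipSyndrome {d : ℕ} (s : Syndrome d) (z : Finset (Qubit d)) : Syndrome d :=
  fun a => s a + ((z.filter fun q => MeasuresY a q).card : ZMod 2)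

/-- `z` and `x` (the qubits of the estimated `Z` errors and `X` errors) are a possible output of the
decoder on the syndrome `s`: update the weights, match the switched-on `X` ancillas, flip the
syndrome, match the switched-on `Z` and `ZY` ancillas. -/
def IsOutput {d : ℕ} (s : Syndrome d) (z x : Finset (Qubit d)) : Prop :=
  IsMWPM (XAnc.Touches (d := d)) (updateWeights s)
    (Finset.univ.filter fun a => s (Sum.inl a) = 1) z ∧
  IsMWPM (ZAnc.Touches (d := d)) (updateWeights s)
    (Finset.univ.filter fun a => flipSyndrome s z (Sum.inr a) = 1) x

/-- `D` is a `ZZZY` decoder, with an arbitrary choice among matchings of equal weight. It maps a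
syndrome to the estimated `Z` errors and `X` errors. -/
def IsDecoder {d : ℕ} (D : Syndrome d → Finset (Qubit d) × Finset (Qubit d)) : Prop :=
  ∀ s, IsOutput s (D s).1 (D s).2

/-- `D` corrects the error with a `Z` on each qubit of `e`: the error times the estimate is a
stabilizer. -/
def Corrects {d : ℕ} (D : Syndrome d → Finset (Qubit d) × Finset (Qubit d))
    (e : Finset (Qubit d)) : Prop :=
  toPauli e ∅ + toPauli (D (syndrome (toPauli e ∅))).1 (D (syndrome (toPauli e ∅))).2
    ∈ stabilizer d

end ZZZY

/-! Write `L` for the symmetric difference of the error `e` and the estimate `z`, `M` for the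
modified qubits of `L`, and `N` for the symmetric difference of `x` and `M`. A `B` generator touches
at most one modified qubit, so a ZY bit reads off whether that qubit lies in `e`
(`syndrome_of_measuresY`). Hence errors weigh at most 1 and other qubits at least 1, strictly so on
modified qubits. A minimum matching of a nonempty set is minimal among all chains with that boundary
(`isMatching_of_endpoints`), so every cycle inside `L` contains at least as many errors as
non-errors, and more if it has a modified qubit (`IsOutput.card_le`). After flipping, the
switched-on `B` generators form the boundary of `M`; thus `L` and `N` are cycles, and the error is
corrected once both are homologically trivial (`mem_stabilizer`).

`Z` part (`IsOutput.colSum_eq_zero`): a nontrivial `L` meets all `d` columns but has at most `2(t+1)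
= d+1` qubits. This forces `L` to be one full lattice row containing `e`. If `e` then has a modified
qubit, the weight `-0.1` makes `e` lighter than the rest of the row, a contradiction.

`X` part (`IsOutput.rowSum_eq_zero`): a nontrivial `N` has an odd number of qubits in each lattice
row. Comparing weights gives `10d ≤ ∑ (20 [row i meets M] + |M in row i|) + 11 |e ∩ z|`. By
`IsOutput.modified_rows_bound` the sum is zero or at most `20 |L ∩ e| - 11`, which is too small.
That bound rests on the alternating positions of the `Y` measurements: a cycle visiting modified
qubits in many rows needs extra qubits for parity reasons.

Conversely (`IsOutput.colSum_ne_zero`), if `e` lies in a row and avoids modified qubits, the rest of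
the row weighs at most `t + 0.2`, whereas an estimate with trivial `L` weighs at least `t + 1`. -/

set_option linter.unusedSectionVars false

namespace ZZZY

/-! ### Chains modulo 2, their boundaries, and matchings -/

section Matching

variable {V Q : Type} [Fintype V] [DecidableEq V] [Fintype Q] [DecidableEq Q]

/-- The characteristic vector of a finite set over `ZMod 2`. -/
def chi (C : Finset Q) : Q → ZMod 2 := fun q => if q ∈ C then 1 else 0

/-- The boundary of a `ZMod 2`-chain with respect to an incidence relation. -/
def bd (T : V → Q → Prop) [∀ v, DecidablePred (T v)] (f : Q → ZMod 2) (v : V) : ZMod 2 :=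
  ∑ q, if T v q then f q else 0

variable (T : V → Q → Prop) [∀ v, DecidablePred (T v)]

lemma zmod_two_cases (a : ZMod 2) : a = 0 ∨ a = 1 := by
  revert a; decide

lemma chi_eq_one {C : Finset Q} {q : Q} : chi C q = 1 ↔ q ∈ C := by
  unfold chi; split_ifs <;> simp_all

lemma chi_eq_zero {C : Finset Q} {q : Q} : chi C q = 0 ↔ q ∉ C := by
  unfold chi; split_ifs <;> simp_all

lemma chi_symmDiff (A B : Finset Q) : chi (symmDiff A B) = chi A + chi B := by
  funext q
  simp only [chi, Finset.mem_symmDiff, Pi.add_apply]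
  by_cases h1 : q ∈ A <;> by_cases h2 : q ∈ B <;> simp [h1, h2]
  decide

lemma bd_add (f g : Q → ZMod 2) : bd T (f + g) = bd T f + bd T g := by
  funext v
  simp only [bd, Pi.add_apply, ← Finset.sum_add_distrib]
  refine Finset.sum_congr rfl fun q _ => ?_
  split_ifs <;> simp

lemma bd_chi (C : Finset Q) (v : V) : bd T (chi C) v = ((C.filter (T v)).card : ZMod 2) := by
  rw [Finset.card_eq_sum_ones, Finset.sum_filter, Nat.cast_sum, bd]
  rw [← Finset.sum_subset (Finset.subset_univ C)]
  · refine Finset.sum_congr rfl fun q hq => ?_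
    simp [chi, hq]
  · intro q _ hq
    simp [chi, hq]

lemma mem_endpoints {C : Finset Q} {v : V} : v ∈ endpoints T C ↔ bd T (chi C) v = 1 := by
  simp [endpoints, bd_chi, ZMod.natCast_eq_one_iff_odd]

lemma endpoints_symmDiff (A B : Finset Q) :
    endpoints T (symmDiff A B) = symmDiff (endpoints T A) (endpoints T B) := by
  ext v
  rw [Finset.mem_symmDiff, mem_endpoints, mem_endpoints, mem_endpoints, chi_symmDiff, bd_add,
    Pi.add_apply]
  rcases zmod_two_cases (bd T (chi A) v) with h | h <;>
    rcases zmod_two_cases (bd T (chi B) v) with h' | h' <;> rw [h, h'] <;> decide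

lemma endpoints_singleton (q : Q) : endpoints T {q} = Finset.univ.filter fun v => T v q := by
  ext v
  simp only [endpoints, Finset.mem_filter, Finset.mem_univ, true_and, Finset.filter_singleton]
  split_ifs with h <;> simp [h]

lemma endpoints_empty : endpoints T (∅ : Finset Q) = ∅ := by
  ext v; simp [endpoints]

lemma endpoints_eq_iff {C : Finset Q} {S : Finset V} :
    endpoints T C = S ↔ ∀ v, bd T (chi C) v = if v ∈ S then 1 else 0 := by
  constructor
  · rintro rfl v
    simp only [mem_endpoints]
    rcases zmod_two_cases (bd T (chi C) v) with h | h <;> simp [h]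
  · intro h
    ext v
    rw [mem_endpoints, h]
    split_ifs with hv <;> simp [hv]

lemma exists_touching {C E : Finset Q} (hCE : C ⊆ E) {v : V}
    (h : ¬ (v ∈ endpoints T C ↔ v ∈ endpoints T E)) : ∃ q ∈ E, q ∉ C ∧ T v q := by
  have hs : symmDiff E C = E \ C := by
    ext q; simp only [Finset.mem_symmDiff, Finset.mem_sdiff]
    have := @hCE q; tauto
  have hv : v ∈ endpoints T (E \ C) := by
    rw [← hs, endpoints_symmDiff, Finset.mem_symmDiff]; tauto
  rw [endpoints, Finset.mem_filter] at hv
  obtain ⟨q, hq⟩ := Finset.card_pos.1 hv.2.pos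
  simp only [Finset.mem_filter, Finset.mem_sdiff] at hq
  exact ⟨q, hq.1.1, hq.1.2, hq.2⟩

lemma insert_eq_symmDiff {C : Finset Q} {q : Q} (h : q ∉ C) : insert q C = symmDiff C {q} := by
  ext x; simp only [Finset.mem_insert, Finset.mem_symmDiff, Finset.mem_singleton]
  by_cases hx : x = q
  · subst hx; simp [h]
  · simp [hx]

variable {T}

/-- A largest subset of `E` with at most two endpoints, one of them `v`, works: were its other
endpoint not an endpoint of `E`, the subset could be prolonged there. -/
lemma exists_chain (hT : ∀ q, (Finset.univ.filter fun v => T v q).card ≤ 2) {E : Finset Q} {v : V}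
    (hv : v ∈ endpoints T E) :
    ∃ C ⊆ E, v ∈ endpoints T C ∧ endpoints T C ⊆ endpoints T E ∧ (endpoints T C).card ≤ 2 := by
  let F := E.powerset.filter fun C => v ∈ endpoints T C ∧ (endpoints T C).card ≤ 2
  have hF : ∀ C, C ∈ F ↔ C ⊆ E ∧ v ∈ endpoints T C ∧ (endpoints T C).card ≤ 2 := by
    intro C; simp [F]
  have hne : F.Nonempty := by
    obtain ⟨q, hq, -, hvq⟩ := exists_touching T (Finset.empty_subset E) (v := v)
      (by simp [endpoints_empty, hv])
    exact ⟨{q}, (hF _).2 ⟨by simpa using hq, by simp [endpoints_singleton, hvq],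
      by rw [endpoints_singleton]; exact hT q⟩⟩
  obtain ⟨C, hCF, hmax⟩ := F.exists_max_image Finset.card hne
  obtain ⟨hCE, hvC, hC2⟩ := (hF C).1 hCF
  refine ⟨C, hCE, hvC, ?_, hC2⟩
  by_contra hsub
  obtain ⟨u, huC, huE⟩ := Finset.not_subset.1 hsub
  have huv : v ≠ u := by rintro rfl; exact huE hv
  have hCeq : endpoints T C = {v, u} := by
    symm
    apply Finset.eq_of_subset_of_card_le
    · intro x; simp only [Finset.mem_insert, Finset.mem_singleton]; rintro (rfl | rfl) <;> assumption
    · rw [Finset.card_pair huv]; exact hC2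
  obtain ⟨q, hqE, hqC, huq⟩ := exists_touching T hCE (v := u) (by tauto)
  have huq' : u ∈ endpoints T {q} := by simp [endpoints_singleton, huq]
  have hq2 : (endpoints T {q}).card ≤ 2 := by rw [endpoints_singleton]; exact hT q
  have hins : endpoints T (insert q C) = symmDiff {v, u} (endpoints T {q}) := by
    rw [insert_eq_symmDiff hqC, endpoints_symmDiff, hCeq]
  have hinsE : insert q C ⊆ E := Finset.insert_subset hqE hCE
  by_cases hvi : v ∈ endpoints T (insert q C)
  · have hcard : (endpoints T (insert q C)).card ≤ 2 := by
      have hsub' : endpoints T (insert q C) ⊆ {v} ∪ (endpoints T {q}).erase u := by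
        intro x; rw [hins]
        simp only [Finset.mem_symmDiff, Finset.mem_insert, Finset.mem_singleton, Finset.mem_union,
          Finset.mem_erase]
        rintro (⟨rfl | rfl, h⟩ | ⟨h, h'⟩)
        · simp
        · exact absurd huq' h
        · push Not at h'; exact Or.inr ⟨h'.2, h⟩
      refine (Finset.card_le_card hsub').trans ((Finset.card_union_le _ _).trans ?_)
      rw [Finset.card_erase_of_mem huq', Finset.card_singleton]; omega
    have := hmax _ ((hF _).2 ⟨hinsE, hvi, hcard⟩)
    rw [Finset.card_insert_of_notMem hqC] at this; omega
  · have hvq : v ∈ endpoints T {q} := by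
      by_contra h; apply hvi; rw [hins, Finset.mem_symmDiff]; simp [h]
    have hqeq : endpoints T {q} = {v, u} := by
      symm
      apply Finset.eq_of_subset_of_card_le
      · intro x; simp only [Finset.mem_insert, Finset.mem_singleton]
        rintro (rfl | rfl) <;> assumption
      · rw [Finset.card_pair huv]; exact hq2
    rw [hqeq, symmDiff_self] at hins
    -- Here `q` joins `u` back to `v` and closes the chain to a cycle; since `v` is still an
    -- endpoint of `E`, a further qubit `p` at `v` yields a larger admissible subset.
    obtain ⟨p, hpE, hpC, hvp⟩ := exists_touching T hinsE (v := v) (by tauto)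
    have hins2 : endpoints T (insert p (insert q C)) = endpoints T {p} := by
      rw [insert_eq_symmDiff hpC, endpoints_symmDiff, hins, bot_symmDiff]
    have := hmax _ ((hF (insert p (insert q C))).2 ⟨Finset.insert_subset hpE hinsE,
      by rw [hins2]; simp [endpoints_singleton, hvp],
      by rw [hins2, endpoints_singleton]; exact hT p⟩)
    rw [Finset.card_insert_of_notMem hpC, Finset.card_insert_of_notMem hqC] at this; omega

lemma disjoint_of_subset_sdiff {C D E : Finset Q} (h : D ⊆ E \ C) : Disjoint C D :=
  Finset.disjoint_left.2 fun _ hx hx' => (Finset.mem_sdiff.1 (h hx')).2 hx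

/-- Chains are peeled off one after another by `exists_chain`, and the last chain absorbs all
remaining closed loops. With nothing to match there is no chain to absorb them, whence the condition
for `S = ∅`. -/
lemma isMatching_of_endpoints (hT : ∀ q, (Finset.univ.filter fun v => T v q).card ≤ 2)
    (S : Finset V) : ∀ E : Finset Q, endpoints T E = S → (S = ∅ → E = ∅) → IsMatching T S E := by
  induction S using Finset.strongInduction with
  | H S ih =>
    intro E hE hE0
    rcases S.eq_empty_or_nonempty with rfl | hS
    · rw [hE0 rfl]
      exact ⟨⊥, fun _ => ∅, by simp, by simp, by simp⟩
    by_cases hS2 : S.card ≤ 2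
    · exact ⟨Finpartition.indiscrete hS.ne_empty, fun _ => E, by simp [hS2, hE], by simp, by simp⟩
    obtain ⟨v, hv⟩ := hS
    obtain ⟨C, hCE, hvC, hsub, hC2⟩ := exists_chain hT (E := E) (v := v) (by rwa [hE])
    rw [hE] at hsub
    have hs : E \ C = symmDiff E C := by
      ext q; simp only [Finset.mem_symmDiff, Finset.mem_sdiff]
      have := @hCE q; tauto
    have hd : endpoints T (E \ C) = S \ endpoints T C := by
      rw [hs, endpoints_symmDiff, hE]
      ext q; simp only [Finset.mem_symmDiff, Finset.mem_sdiff]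
      have := @hsub q; tauto
    obtain ⟨P, c, h1, h2, h3⟩ := ih (S \ endpoints T C)
      (Finset.sdiff_ssubset hsub ⟨v, hvC⟩) (E \ C) hd (by
        intro h0; exfalso; apply hS2
        rw [Finset.sdiff_eq_empty_iff_subset] at h0
        exact (Finset.card_le_card h0).trans hC2)
    have hB : ∀ B ∈ P.parts, B ≠ endpoints T C := by
      rintro B hB rfl
      exact (Finset.mem_sdiff.1 (P.le hB hvC)).2 hvC
    let c' : Finset V → Finset Q := fun B => if B = endpoints T C then C else c B
    have hc' : ∀ B ∈ P.parts, c' B = c B := fun B hb => by simp [c', hB B hb]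
    have hcs : ∀ B ∈ P.parts, c B ⊆ E \ C := fun B hb => by
      rw [h3]; exact Finset.subset_biUnion_of_mem c hb
    refine ⟨P.extend (b := endpoints T C) (c := S) (Finset.nonempty_iff_ne_empty.1 ⟨v, hvC⟩)
      Finset.sdiff_disjoint (by simpa using hsub), c', ?_, ?_, ?_⟩
    · intro B hb
      rw [Finpartition.extend_parts, Finset.mem_insert] at hb
      rcases hb with rfl | hb
      · simp [c', hC2]
      · rw [hc' B hb]; exact h1 B hb
    · rw [Finpartition.extend_parts, Finset.coe_insert]
      refine Set.PairwiseDisjoint.insert ?_ ?_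
      · intro B hb B' hb' hne
        simp only [Function.onFun]
        rw [hc' B hb, hc' B' hb']; exact h2 hb hb' hne
      · intro B hb _
        rw [hc' B hb]
        simpa [c'] using disjoint_of_subset_sdiff (hcs B hb)
    · rw [Finpartition.extend_parts, Finset.biUnion_insert, Finset.biUnion_congr rfl hc', ← h3]
      simp [c', hCE]

lemma bd_chi_biUnion {ι : Type} [DecidableEq ι] (P : Finset ι) (c : ι → Finset Q)
    (h : (P : Set ι).PairwiseDisjoint c) (v : V) :
    bd T (chi (P.biUnion c)) v = ∑ B ∈ P, bd T (chi (c B)) v := by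
  simp only [bd_chi]
  rw [Finset.filter_biUnion, Finset.card_biUnion, Nat.cast_sum]
  intro B hB B' hB' hne
  exact Finset.disjoint_filter_filter (h hB hB' hne)

lemma IsMatching.endpoints_eq {S : Finset V} {E : Finset Q} (h : IsMatching T S E) :
    endpoints T E = S := by
  obtain ⟨P, c, h1, h2, rfl⟩ := h
  rw [endpoints_eq_iff]
  intro v
  rw [bd_chi_biUnion _ _ h2]
  have : ∀ B ∈ P.parts, bd T (chi (c B)) v = if v ∈ B then 1 else 0 := fun B hB =>
    (endpoints_eq_iff T).1 (h1 B hB).2 v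
  rw [Finset.sum_congr rfl this]
  split_ifs with hv
  · obtain ⟨B, ⟨hB, hvB⟩, huniq⟩ := P.existsUnique_mem hv
    rw [Finset.sum_eq_single_of_mem B hB, if_pos hvB]
    intro B' hB' hne
    rw [if_neg]
    intro hvB'; exact hne (huniq B' ⟨hB', hvB'⟩)
  · refine Finset.sum_eq_zero fun B hB => if_neg fun hvB => hv (P.le hB hvB)

lemma IsMatching.eq_empty {E : Finset Q} (h : IsMatching T ∅ E) : E = ∅ := by
  obtain ⟨P, c, h1, h2, rfl⟩ := h
  have : P.parts = ∅ := by
    rw [Finpartition.parts_eq_empty_iff]; rfl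
  simp [this]

lemma exists_isMWPM (w : Q → ℚ) {S : Finset V} (h : ∃ E, IsMatching T S E) :
    ∃ E, IsMWPM T w S E := by
  classical
  obtain ⟨E0, h0⟩ := h
  obtain ⟨E, hE, hmin⟩ := (Finset.univ.filter fun E : Finset Q => IsMatching T S E).exists_min_image
    (fun E => ∑ q ∈ E, w q) ⟨E0, by simpa using h0⟩
  exact ⟨E, by simpa using hE, fun E' h' => hmin E' (by simpa using h')⟩

/-- A minimum weight perfect matching of a nonempty set is minimal among all chains with the same
boundary. -/
lemma IsMWPM.le_of_bd (hT : ∀ q, (Finset.univ.filter fun v => T v q).card ≤ 2) {w : Q → ℚ}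
    {S : Finset V} {E E' : Finset Q} (h : IsMWPM T w S E) (hS : S ≠ ∅)
    (h' : endpoints T E' = S) : ∑ q ∈ E, w q ≤ ∑ q ∈ E', w q :=
  h.2 E' (isMatching_of_endpoints hT S E' h' fun h0 => absurd h0 hS)

end Matching

/-! ### Homology of the planar lattice and the stabilizer group -/

section Lattice

variable {d : ℕ}

/-- The value of a chain on the lattice qubit `q_{i,j}`, extended by zero. -/
def hor (f : Qubit d → ZMod 2) (i j : ℕ) : ZMod 2 :=
  if h : i < d ∧ j < d then f (Sum.inl (⟨i, h.1⟩, ⟨j, h.2⟩)) else 0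

/-- The value of a chain on the qubit in position `c` of the intermediate row directly above
lattice row `b`, extended by zero. -/
def ver (f : Qubit d → ZMod 2) (b c : ℕ) : ZMod 2 :=
  if h : 0 < b ∧ b - 1 < d - 1 ∧ c < d - 1 then f (Sum.inr (⟨b - 1, h.2.1⟩, ⟨c, h.2.2⟩)) else 0

lemma hor_fin (f : Qubit d → ZMod 2) (i j : Fin d) : hor f i j = f (Sum.inl (i, j)) := by
  simp [hor]

lemma ver_fin (f : Qubit d → ZMod 2) (b c : Fin (d - 1)) :
    ver f (b + 1) c = f (Sum.inr (b, c)) := by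
  simp [ver]

lemma ver_zero (f : Qubit d → ZMod 2) (c : ℕ) : ver f 0 c = 0 := by simp [ver]

lemma ver_top (f : Qubit d → ZMod 2) {b : ℕ} (hb : d ≤ b) (c : ℕ) : ver f b c = 0 := by
  rw [ver, dif_neg]; omega

lemma hor_add (f g : Qubit d → ZMod 2) (i j : ℕ) : hor (f + g) i j = hor f i j + hor g i j := by
  simp only [hor, Pi.add_apply]; split_ifs <;> simp

/-- The reflection of the lattice in its diagonal. It exchanges the two kinds of ancillas. -/
def transpose (d : ℕ) : Qubit d ≃ Qubit d :=
  Equiv.sumCongr (Equiv.prodComm _ _) (Equiv.prodComm _ _)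

lemma touches_transpose (a : ZAnc d) (q : Qubit d) :
    XAnc.Touches (d := d) a.swap (transpose d q) ↔ a.Touches q := by
  rcases q with ⟨i, j⟩ | ⟨i, c⟩ <;> exact Iff.rfl

lemma bd_transpose (f : Qubit d → ZMod 2) (a : ZAnc d) :
    bd (ZAnc.Touches (d := d)) f a = bd (XAnc.Touches (d := d)) (f ∘ (transpose d).symm) a.swap := by
  unfold bd
  refine Fintype.sum_equiv (transpose d) _ _ fun q => ?_
  simp [touches_transpose]

lemma bdX_eq (f : Qubit d → ZMod 2) (i : Fin d) (c : Fin (d - 1)) :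
    bd (XAnc.Touches (d := d)) f (i, c) =
      hor f i c + hor f i (c + 1) + (ver f i c + ver f (i + 1) c) := by
  have hc := c.2
  have hi := i.2
  unfold bd
  rw [Fintype.sum_sum_type]
  congr 1
  · rw [Fintype.sum_prod_type, Finset.sum_eq_single i]
    · have e1 : hor f i c = f (Sum.inl (i, ⟨c, by omega⟩)) := by
        rw [hor, dif_pos (by omega)]
      have e2 : hor f i (c + 1) = f (Sum.inl (i, ⟨c + 1, by omega⟩)) := by
        rw [hor, dif_pos (by omega)]
      rw [e1, e2, ← Finset.sum_pair (f := fun j => f (Sum.inl (i, j))), ← Finset.sum_subset (Finset.subset_univ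
        ({⟨c, by omega⟩, ⟨c + 1, by omega⟩} : Finset (Fin d)))]
      · refine Finset.sum_congr rfl fun j hj => if_pos ?_
        simp only [Finset.mem_insert, Finset.mem_singleton, Fin.ext_iff] at hj
        exact ⟨rfl, hj⟩
      · intro j _ hj
        simp only [Finset.mem_insert, Finset.mem_singleton, Fin.ext_iff] at hj
        exact if_neg fun h => hj h.2
      · simp
    · intro i' _ hne
      exact Finset.sum_eq_zero fun j _ => if_neg fun h => hne h.1
    · simp
  · rw [Fintype.sum_prod_type_right, Finset.sum_eq_single c]
    · have : ∀ b : Fin (d - 1), (if XAnc.Touches (d := d) (i, c) (Sum.inr (b, c)) then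
          f (Sum.inr (b, c)) else 0) =
          (if b.val + 1 = i.val then f (Sum.inr (b, c)) else 0) +
          (if b.val = i.val then f (Sum.inr (b, c)) else 0) := by
        intro b
        have : XAnc.Touches (d := d) (i, c) (Sum.inr (b, c)) ↔
          (b.val = i.val ∨ b.val + 1 = i.val) := by simp [XAnc.Touches]
        by_cases h1 : b.val = i.val
        · simp [this, h1]
        · simp [this, h1]
      simp only [this, Finset.sum_add_distrib]
      congr 1
      · by_cases h0 : 0 < i.val
        · rw [ver, dif_pos (by omega), Finset.sum_eq_single ⟨i - 1, by omega⟩]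
          · rw [if_pos]; simp only; omega
          · intro b _ hne
            rw [if_neg]
            intro h; apply hne; ext; simp only; omega
          · simp
        · rw [ver, dif_neg (by omega)]
          exact Finset.sum_eq_zero fun b _ => if_neg (by omega)
      · by_cases h0 : i.val < d - 1
        · rw [ver, dif_pos (by omega), Finset.sum_eq_single ⟨i, by omega⟩]
          · rw [if_pos rfl]; simp
          · intro b _ hne
            rw [if_neg]
            intro h; apply hne; ext; exact h
          · simp
        · rw [ver, dif_neg (by omega)]
          exact Finset.sum_eq_zero fun b _ => if_neg (by omega)
    · intro c' _ hne
      exact Finset.sum_eq_zero fun j _ => if_neg fun h => hne h.1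
    · simp

/-- The cycles of the `X` ancillas. -/
def XCycle (f : Qubit d → ZMod 2) : Prop := ∀ a, bd (XAnc.Touches (d := d)) f a = 0

/-- The cycles of the `Z` ancillas. -/
def ZCycle (f : Qubit d → ZMod 2) : Prop := ∀ a, bd (ZAnc.Touches (d := d)) f a = 0

lemma XCycle.eq {f : Qubit d → ZMod 2} (h : XCycle f) {i c : ℕ} (hi : i < d) (hc : c < d - 1) :
    hor f i c + hor f i (c + 1) + (ver f i c + ver f (i + 1) c) = 0 :=
  (bdX_eq f ⟨i, hi⟩ ⟨c, hc⟩).symm.trans (h _)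

lemma ZCycle.xCycle_transpose {f : Qubit d → ZMod 2} (h : ZCycle f) : XCycle (f ∘ (transpose d).symm) := fun a => by
  have := bd_transpose f a.swap
  rw [Prod.swap_swap] at this
  rw [← this]; exact h _

/-- The sum of a chain over column `j` of the lattice rows. -/
def colSum (f : Qubit d → ZMod 2) (j : ℕ) : ZMod 2 := ∑ i ∈ Finset.range d, hor f i j

/-- The sum of a chain over lattice row `i`. -/
def rowSum (f : Qubit d → ZMod 2) (i : ℕ) : ZMod 2 := ∑ j ∈ Finset.range d, hor f i j

lemma colSum_transpose (f : Qubit d → ZMod 2) (i : ℕ) :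
    colSum (f ∘ (transpose d).symm) i = rowSum f i := by
  unfold colSum rowSum hor
  refine Finset.sum_congr rfl fun j _ => ?_
  simp only [and_comm]
  rfl

lemma zmod_two_add_self (a : ZMod 2) : a + a = 0 := by revert a; decide

lemma zmod_two_eq_of_add {a b : ZMod 2} (h : a + b = 0) : a = b := by revert a b; decide

/-- Adding the equations of the ancillas `(i, c)` with `i < b`, the intermediate rows telescope. -/
lemma ver_eq_sum {f : Qubit d → ZMod 2} (h : XCycle f) {c : ℕ} (hc : c < d - 1) {b : ℕ}
    (hb : b ≤ d) : ∑ i ∈ Finset.range b, hor f i c + ∑ i ∈ Finset.range b, hor f i (c + 1) =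
      ver f b c := by
  induction b with
  | zero => simp [ver_zero]
  | succ b ih =>
    have h1 := ih (by omega)
    have h2 := h.eq (i := b) (by omega) hc
    rw [Finset.sum_range_succ, Finset.sum_range_succ]
    generalize ∑ i ∈ Finset.range b, hor f i c = x at *
    generalize ∑ i ∈ Finset.range b, hor f i (c + 1) = y at *
    rw [← h1] at h2
    generalize hor f b c = x' at *
    generalize hor f b (c + 1) = y' at *
    generalize ver f (b + 1) c = z at *
    revert h2; clear h1 ih; revert x y x' y' z; decide

lemma colSum_const {f : Qubit d → ZMod 2} (h : XCycle f) {j : ℕ} (hj : j < d) :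
    colSum f j = colSum f 0 := by
  induction j with
  | zero => rfl
  | succ j ih =>
    rw [← ih (by omega)]
    have := ver_eq_sum h (c := j) (by omega) le_rfl
    rw [ver_top f le_rfl] at this
    exact (zmod_two_eq_of_add this).symm

lemma rowSum_const {f : Qubit d → ZMod 2} (h : ZCycle f) {i : ℕ} (hi : i < d) :
    rowSum f i = rowSum f 0 := by
  rw [← colSum_transpose, ← colSum_transpose]; exact colSum_const h.xCycle_transpose hi

/-- A cycle that is even on the columns is a boundary. -/
lemma XCycle.exists_eq {f : Qubit d → ZMod 2} (h : XCycle f) (h0 : colSum f 0 = 0) :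
    ∃ k : ZAnc d → ZMod 2, ∀ q, f q = ∑ a, if ZAnc.Touches (d := d) a q then k a else 0 := by
  -- The coefficient of a `Z` ancilla is the sum of its column from the top down to it. At the
  -- bottom boundary this prefix sum vanishes because the column is even.
  let K : ℕ → ℕ → ZMod 2 := fun b j => ∑ i ∈ Finset.range b, hor f i j
  have hKd : ∀ j, j < d → K d j = 0 := fun j hj => (colSum_const h hj).trans h0
  refine ⟨fun a => K (a.1 + 1) a.2, ?_⟩
  rintro (⟨i, j⟩ | ⟨b, c⟩)
  · have hi := i.2
    have hj := j.2
    rw [Fintype.sum_prod_type_right, Finset.sum_eq_single j]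
    · have : ∀ b : Fin (d - 1), (if ZAnc.Touches (d := d) (b, j) (Sum.inl (i, j)) then
          K (b + 1) j else 0) =
          (if b.val = i.val then K (i + 1) j else 0) +
          (if b.val + 1 = i.val then K i j else 0) := by
        intro b
        have : ZAnc.Touches (d := d) (b, j) (Sum.inl (i, j)) ↔
          (i.val = b.val ∨ i.val = b.val + 1) := by simp [ZAnc.Touches]
        by_cases h1 : b.val = i.val
        · simp [this, h1]
        · by_cases h2 : b.val + 1 = i.val
          · simp [this, ← h2]
          · simp [this, h1, h2, Ne.symm h1, Ne.symm h2]
      simp only [this, Finset.sum_add_distrib]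
      have e1 : (∑ b : Fin (d - 1), if b.val = i.val then K (i + 1) j else 0) = K (i + 1) j := by
        by_cases h1 : i.val < d - 1
        · rw [Finset.sum_eq_single ⟨i, h1⟩]
          · simp
          · intro b _ hne
            rw [if_neg]
            intro h; apply hne; ext; exact h
          · simp
        · rw [show (i : ℕ) + 1 = d by omega, hKd _ hj]; simp
      have e2 : (∑ b : Fin (d - 1), if b.val + 1 = i.val then K i j else 0) = K i j := by
        by_cases h1 : 0 < i.val
        · rw [Finset.sum_eq_single ⟨i - 1, by omega⟩]
          · rw [if_pos]; simp only; omega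
          · intro b _ hne
            rw [if_neg]
            intro h; apply hne; ext; simp only; omega
          · simp
        · rw [show (i : ℕ) = 0 by omega]; simp [K]
      rw [e1, e2, ← hor_fin f]
      simp only [K, Finset.sum_range_succ]
      rw [add_right_comm, zmod_two_add_self, zero_add]
    · intro j' _ hne
      exact Finset.sum_eq_zero fun b _ => if_neg fun h => hne h.1.symm
    · simp
  · have hb := b.2
    have hc := c.2
    rw [Fintype.sum_prod_type, Finset.sum_eq_single b]
    · rw [← ver_fin f, ← ver_eq_sum h hc (by omega)]
      rw [← Finset.sum_subset (Finset.subset_univ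
        ({⟨c, by omega⟩, ⟨c + 1, by omega⟩} : Finset (Fin d)))]
      · rw [Finset.sum_pair (by simp), if_pos, if_pos]
        · exact ⟨rfl, Or.inr rfl⟩
        · exact ⟨rfl, Or.inl rfl⟩
      · intro j _ hj
        simp only [Finset.mem_insert, Finset.mem_singleton, Fin.ext_iff] at hj
        exact if_neg fun h => hj (h.2.imp Eq.symm Eq.symm)
    · intro b' _ hne
      exact Finset.sum_eq_zero fun j _ => if_neg fun h => hne h.1.symm
    · simp

lemma ZCycle.exists_eq {f : Qubit d → ZMod 2} (h : ZCycle f) (h0 : rowSum f 0 = 0) :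
    ∃ k : XAnc d → ZMod 2, ∀ q, f q = ∑ a, if XAnc.Touches (d := d) a q then k a else 0 := by
  obtain ⟨k, hk⟩ := h.xCycle_transpose.exists_eq (by rw [colSum_transpose]; exact h0)
  refine ⟨fun a => k a.swap, fun q => ?_⟩
  have := hk (transpose d q)
  rw [Function.comp_apply, Equiv.symm_apply_apply] at this
  rw [this]
  refine Fintype.sum_equiv (Equiv.prodComm _ _) _ _ fun a => ?_
  have : XAnc.Touches (d := d) a.swap q ↔ ZAnc.Touches (d := d) a (transpose d q) := by
    rcases q with ⟨i, j⟩ | ⟨i, c⟩ <;> exact Iff.rfl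
  simp [this]

/-! ### The stabilizer group -/

/-- The `B` generators that produce `f` also contribute an `X` part, namely `f` on the modified
qubits. Only after adding this correction must the `X` part be a product of `X` generators. -/
lemma mem_stabilizer {f g : Qubit d → ZMod 2} (hf : XCycle f) (hf0 : colSum f 0 = 0)
    (hg : ZCycle fun q => g q + if Modified q then f q else 0)
    (hg0 : rowSum (fun q => g q + if Modified q then f q else 0) 0 = 0) :
    ((f, g) : Pauli d) ∈ stabilizer d := by
  obtain ⟨k, hk⟩ := hf.exists_eq hf0
  obtain ⟨l, hl⟩ := hg.exists_eq hg0
  have : ((f, g) : Pauli d) = ∑ a, k a • gen d (Sum.inr a) + ∑ a, l a • gen d (Sum.inl a) := by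
    refine Prod.ext (funext fun q => ?_) (funext fun q => ?_)
    · simp [gen, Prod.fst_sum, hk q]
    · have h1 := hl q
      simp only [gen, Prod.snd_add, Prod.snd_sum, Prod.smul_snd, Pi.add_apply, Finset.sum_apply,
        Pi.smul_apply, smul_eq_mul, mul_ite, mul_one, mul_zero]
      rw [← h1]
      by_cases hm : Modified q
      · simp only [hm, and_true, if_true]
        rw [← hk, add_left_comm, zmod_two_add_self, add_zero]
      · simp [hm]
  rw [this]
  exact Submodule.add_mem _
    (Submodule.sum_mem _ fun a _ => Submodule.smul_mem _ _ (Submodule.subset_span ⟨_, rfl⟩))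
    (Submodule.sum_mem _ fun a _ => Submodule.smul_mem _ _ (Submodule.subset_span ⟨_, rfl⟩))

/-- An `X` generator has no `Z` part, and a `B` generator meets a column of the lattice rows in zero
or two qubits. -/
lemma colSum_of_mem_stabilizer {p : Pauli d} (hp : p ∈ stabilizer d) {j : ℕ} (hj : j < d) :
    colSum p.1 j = 0 := by
  induction hp using Submodule.span_induction with
  | mem p hp =>
    obtain ⟨a | a, rfl⟩ := hp
    · simp [gen, colSum, hor]
    · have ha := a.1.2
      simp only [gen, colSum, hor, hj, and_true]
      by_cases hja : j = a.2.val
      · rw [← Finset.sum_subset (s₁ := {a.1.val, a.1.val + 1})]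
        · rw [Finset.sum_pair (by simp), dif_pos (by omega), dif_pos (by omega), if_pos, if_pos]
          · decide
          · exact ⟨Fin.ext hja, Or.inr rfl⟩
          · exact ⟨Fin.ext hja, Or.inl rfl⟩
        · intro x; simp only [Finset.mem_insert, Finset.mem_singleton, Finset.mem_range]; omega
        · intro x hx hx'
          simp only [Finset.mem_insert, Finset.mem_singleton] at hx'
          rw [dif_pos (by simpa using hx), if_neg]
          exact fun h => hx' h.2
      · refine Finset.sum_eq_zero fun i hi => ?_
        rw [dif_pos (by simpa using hi), if_neg]
        exact fun h => hja (congrArg Fin.val h.1)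
  | zero => simp [colSum, hor]
  | add x y _ _ hx hy =>
    simp only [colSum, Prod.fst_add, hor_add, Finset.sum_add_distrib] at *
    rw [hx, hy, add_zero]
  | smul c x _ hx =>
    rcases zmod_two_cases c with rfl | rfl
    · simp [colSum, hor]
    · simpa using hx

end Lattice

/-! ### Counting the modified qubits of a cycle row by row -/

section Counting

open Finset

/-- Data of a cycle in the lattice: `rl i` is the number of its qubits in lattice row `i`, `rm i`
the number of the modified ones among them, and `rv b` the number of its qubits in the intermediate
row above lattice row `b`. -/
structure IsRowProfile (d : ℕ) (rl rm rv : ℕ → ℕ) : Prop where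
  le : ∀ i, rm i ≤ rl i
  even_row : ∀ i < d, i % 2 = 0 → rl i = 1 → rm i = 1 → (rv i + rv (i + 1)) % 2 = 1
  odd_row : ∀ i < d, i % 2 = 1 → rl i = 1 → rm i = 1 → (rv i + rv (i + 1)) % 2 = 0
  even_length : ∀ p q, p < q → q ≤ d → rv p = 0 → rv q = 0 →
    (∀ i, p ≤ i → i < q → rl i = 1 ∧ rm i = 1) → (q - p) % 2 = 0

/-- `0` or `1` according to whether a row contains a modified qubit of the cycle. -/
def hasMod (rm : ℕ → ℕ) (i : ℕ) : ℕ := if rm i = 0 then 0 else 1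

lemma hasMod_cases (rm : ℕ → ℕ) (i : ℕ) :
    (rm i = 0 ∧ hasMod rm i = 0) ∨ (1 ≤ rm i ∧ hasMod rm i = 1) := by
  unfold hasMod; split_ifs <;> omega

variable {d : ℕ} {rl rm rv : ℕ → ℕ}

/-- A modified row and the occupied intermediate row above it use at least two qubits. An even row
whose only qubit is modified has neighbouring intermediate rows of different parity, so it forces a
third qubit there; the excess over two per modified row thus grows by about one for every two rows.
At even `n` the term `2 * rv n` cancels the contribution of intermediate row `n`, which is saved for
the even row `n` below it. -/
lemma IsRowProfile.excess_growth (h : IsRowProfile d rl rm rv) {p q : ℕ} (hq : q ≤ d)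
    (hp0 : rv p = 0) (hpos : ∀ b, p < b → b < q → 0 < rv b) (n : ℕ) (hn : p + 1 ≤ n) :
    n < q →
    (n % 2 = 0 → 4 * ∑ i ∈ Ico p n, hasMod rm i + (n - p) + 2 * rv n ≤
      2 * (∑ i ∈ Ico p n, (rl i + rv i) + rv n) + 4) ∧
    (n % 2 = 1 → 4 * ∑ i ∈ Ico p n, hasMod rm i + (n - p) ≤
      2 * (∑ i ∈ Ico p n, (rl i + rv i) + rv n) + 1) := by
  induction n, hn using Nat.le_induction with
  | base =>
    intro hlt
    have h1 := hpos (p + 1) (by omega) hlt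
    have h2 := h.le p
    have h3 := hasMod_cases rm p
    simp only [Nat.Ico_succ_singleton, sum_singleton, hp0]
    omega
  | succ n hn ih =>
    intro hlt
    have h0 := hpos n (by omega) (by omega)
    have h1 := hpos (n + 1) (by omega) hlt
    have h2 := h.le n
    have h3 := hasMod_cases rm n
    have h4 := h.even_row n (by omega)
    have ih := ih (by omega)
    rw [sum_Ico_succ_top (by omega), sum_Ico_succ_top (by omega)]
    omega

/-- For one piece between consecutive empty intermediate rows, `U` counts errors and `W` non-errors.
Its size bounds the number of modified rows and of modified qubits, and `W < U` turns this into a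
bound by `U`. The slack 11 is what the final comparison with `10 * d` needs. -/
lemma IsRowProfile.component_bound (h : IsRowProfile d rl rm rv) {p q : ℕ} (hpq : p < q)
    (hq : q ≤ d) (hp0 : rv p = 0) (hq0 : rv q = 0) (hpos : ∀ b, p < b → b < q → 0 < rv b)
    {U W : ℕ} (hUW : U + W = ∑ i ∈ Ico p q, (rl i + rv i)) (hlt : 0 < ∑ i ∈ Ico p q, rm i → W < U) :
    ∑ i ∈ Ico p q, (20 * hasMod rm i + rm i) = 0 ∨
      ∑ i ∈ Ico p q, (20 * hasMod rm i + rm i) + 11 ≤ 20 * U := by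
  rcases Nat.eq_zero_or_pos (∑ i ∈ Ico p q, rm i) with h0 | h0
  · left
    refine sum_eq_zero fun i hi => ?_
    have h1 := (sum_eq_zero_iff.1 h0) i hi
    have h3 := hasMod_cases rm i
    omega
  right
  have hlt := hlt h0
  obtain ⟨r, rfl⟩ : ∃ r, q = r + 1 := ⟨q - 1, by omega⟩
  have hgrow : 4 * ∑ i ∈ Ico p (r + 1), hasMod rm i + (r - p) ≤
      2 * (∑ i ∈ Ico p (r + 1), (rl i + rv i)) + 4 := by
    rcases Nat.eq_or_lt_of_le (Nat.lt_succ_iff.1 hpq) with rfl | hpr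
    · have h3 := hasMod_cases rm p
      have h2 := h.le p
      simp only [Nat.Ico_succ_singleton, sum_singleton]
      omega
    · have h1 := h.excess_growth hq hp0 hpos r hpr (by omega)
      have h3 := hasMod_cases rm r
      have h2 := h.le r
      have h4 := hpos r hpr (by omega)
      rw [sum_Ico_succ_top (by omega), sum_Ico_succ_top (by omega)]
      omega
  have hcell : ∀ i ∈ Ico (p + 1) (r + 1), 2 * hasMod rm i ≤ rl i + rv i := by
    intro i hi
    rw [mem_Ico] at hi
    have h1 := hpos i (by omega) (by omega)
    have h2 := h.le i
    have h3 := hasMod_cases rm i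
    omega
  have hfirst : 2 * hasMod rm p ≤ rl p + rv p + 1 := by
    have h2 := h.le p
    have h3 := hasMod_cases rm p
    omega
  have hsplit : ∀ f : ℕ → ℕ, ∑ i ∈ Ico p (r + 1), f i = f p + ∑ i ∈ Ico (p + 1) (r + 1), f i :=
    fun f => sum_eq_sum_Ico_succ_bot hpq f
  -- Only the first row of the piece may lack an intermediate qubit above it, so failure makes every
  -- estimate tight: each row is a single modified qubit, with one intermediate qubit above it
  -- except at the top. Then `hgrow` and the even length leave only two rows, and the one with odd
  -- index violates `odd_row`.
  have hexc : 2 * ∑ i ∈ Ico p (r + 1), hasMod rm i ≤ ∑ i ∈ Ico p (r + 1), (rl i + rv i) := by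
    by_contra hcon
    have hsum := sum_le_sum hcell
    rw [← mul_sum] at hsum
    rw [hsplit, hsplit] at hcon
    have heq : ∑ i ∈ Ico (p + 1) (r + 1), 2 * hasMod rm i =
        ∑ i ∈ Ico (p + 1) (r + 1), (rl i + rv i) := by
      rw [← mul_sum]; omega
    rw [sum_eq_sum_iff_of_le hcell] at heq
    have hone : ∀ i, p ≤ i → i < r + 1 → rl i = 1 ∧ rm i = 1 ∧ (i ≠ p → rv i = 1) := by
      intro i hi hi'
      have h2 := h.le i
      have h3 := hasMod_cases rm i
      rcases Nat.eq_or_lt_of_le hi with rfl | hi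
      · omega
      · have h1 := hpos i hi hi'
        have h4 := heq i (mem_Ico.2 ⟨hi, hi'⟩)
        omega
    have heven := h.even_length p (r + 1) hpq hq hp0 hq0
      fun i hi hi' => ⟨(hone i hi hi').1, (hone i hi hi').2.1⟩
    rw [hsplit, hsplit] at hgrow
    have hr : r = p + 1 := by omega
    subst hr
    have h1 := hone p (by omega) (by omega)
    have h2 := hone (p + 1) (by omega) (by omega)
    have h3 := h.odd_row p (by omega)
    have h4 := h.odd_row (p + 1) (by omega)
    omega
  have hmod : ∑ i ∈ Ico p (r + 1), rm i + (r - p) ≤ ∑ i ∈ Ico p (r + 1), (rl i + rv i) := by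
    have h1 : ∑ i ∈ Ico (p + 1) (r + 1), (rm i + 1) ≤ ∑ i ∈ Ico (p + 1) (r + 1), (rl i + rv i) := by
      refine sum_le_sum fun i hi => ?_
      rw [mem_Ico] at hi
      have h1 := hpos i (by omega) (by omega)
      have h2 := h.le i
      omega
    rw [sum_add_distrib] at h1
    simp only [sum_const, Nat.card_Ico, smul_eq_mul, mul_one] at h1
    rw [hsplit, hsplit]
    have h2 := h.le p
    omega
  have hcount : ∑ i ∈ Ico p (r + 1), hasMod rm i ≤ r + 1 - p := by
    have := sum_le_card_nsmul (Ico p (r + 1)) (hasMod rm) 1 fun i _ => by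
      have h3 := hasMod_cases rm i
      omega
    simpa using this
  rw [sum_add_distrib, ← mul_sum]
  rw [← hUW] at hgrow hexc hmod
  generalize ∑ i ∈ Ico p (r + 1), hasMod rm i = g at *
  generalize ∑ i ∈ Ico p (r + 1), rm i = f at *
  clear hUW hcell hsplit hfirst hpos
  -- Put `k = U - g`. Since `U + W ≤ 2U - 1`, `hexc` gives `k ≥ 1`; `hgrow` and `hcount` give `g ≤
  -- 4k + 3`; `hmod` and `hcount` give `f ≤ 2k + g ≤ 6k + 3`. Hence `f + 11 ≤ 6k + 14 ≤ 20k`.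
  rcases Nat.eq_or_lt_of_le hexc with hx | hx
  · have : g + 1 ≤ U := by omega
    omega
  · have : U + W + 1 ≤ 2 * U := by omega
    omega

/-- If a cycle is composed of `U` and `W` such that no part of the cycle cut out by empty
intermediate rows contains more qubits of `W` than of `U`, and strictly fewer if it contains
modified qubits, then the modified rows are bounded by the number of qubits of `U`. -/
lemma IsRowProfile.bound (h : IsRowProfile d rl rm rv) (h0 : rv 0 = 0) {u w : ℕ → ℕ}
    (huw : ∀ i, u i + w i = rl i + rv i)
    (hlt : ∀ p q, p < q → q ≤ d → rv p = 0 → rv q = 0 → 0 < ∑ i ∈ Ico p q, rm i →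
      ∑ i ∈ Ico p q, w i < ∑ i ∈ Ico p q, u i) (q : ℕ) :
    q ≤ d → rv q = 0 → ∑ i ∈ range q, (20 * hasMod rm i + rm i) = 0 ∨
      ∑ i ∈ range q, (20 * hasMod rm i + rm i) + 11 ≤ 20 * ∑ i ∈ range q, u i := by
  induction q using Nat.strong_induction_on with
  | _ q ih =>
    intro hq hq0
    rcases Nat.eq_zero_or_pos q with rfl | hqpos
    · left; simp
    -- The last empty intermediate row before `q` splits off the final piece.
    obtain ⟨p, hp, hpmax⟩ := ((range q).filter fun b => rv b = 0).exists_max_image id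
      ⟨0, by simp [hqpos, h0]⟩
    rw [mem_filter, mem_range] at hp
    have h1 := ih p hp.1 (by omega) hp.2
    have h2 := h.component_bound hp.1 hq hp.2 hq0 (fun b hb hb' => by
      by_contra hb0
      have := hpmax b (by simp only [mem_filter, mem_range]; omega)
      simp only [id] at this; omega) (U := ∑ i ∈ Ico p q, u i) (W := ∑ i ∈ Ico p q, w i)
      (by rw [← sum_add_distrib]; exact sum_congr rfl fun i _ => huw i)
      (hlt p q hp.1 hq hp.2 hq0)
    rw [← sum_range_add_sum_Ico _ hp.1.le, ← sum_range_add_sum_Ico u hp.1.le]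
    omega

end Counting

/-! ### Existence of decoders; syndromes and weights of `Z` errors -/

section Decoding

variable {d : ℕ}

lemma card_xAnc_touching (q : Qubit d) :
    (Finset.univ.filter fun a => XAnc.Touches (d := d) a q).card ≤ 2 := by
  rcases q with ⟨i, j⟩ | ⟨b, c⟩
  · refine (Finset.card_le_card_of_injOn (t := {j.val, j.val - 1}) (fun a => a.2.val) ?_ ?_).trans
      Finset.card_le_two
    · intro a ha
      have ha := (Finset.mem_filter.1 ha).2.2
      simp only [Finset.coe_insert, Finset.coe_singleton, Set.mem_insert_iff,
        Set.mem_singleton_iff]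
      omega
    · intro a ha a' ha' h
      have ha := (Finset.mem_filter.1 ha).2.1
      have ha' := (Finset.mem_filter.1 ha').2.1
      exact Prod.ext (ha.symm.trans ha') (Fin.ext h)
  · refine (Finset.card_le_card_of_injOn (t := {b.val, b.val + 1}) (fun a => a.1.val) ?_ ?_).trans
      Finset.card_le_two
    · intro a ha
      have ha := (Finset.mem_filter.1 ha).2.2
      simp only [Finset.coe_insert, Finset.coe_singleton, Set.mem_insert_iff,
        Set.mem_singleton_iff]
      omega
    · intro a ha a' ha' h
      have ha := (Finset.mem_filter.1 ha).2.1
      have ha' := (Finset.mem_filter.1 ha').2.1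
      exact Prod.ext (Fin.ext h) (ha.symm.trans ha')

lemma card_zAnc_touching (q : Qubit d) :
    (Finset.univ.filter fun a => ZAnc.Touches (d := d) a q).card ≤ 2 := by
  refine (Finset.card_le_card_of_injOn Prod.swap ?_ Prod.swap_injective.injOn).trans
    (card_xAnc_touching (transpose d q))
  intro a ha
  simpa [touches_transpose] using ha

lemma exists_endpoints_eq {V Q : Type} [Fintype V] [DecidableEq V] [Fintype Q] [DecidableEq Q]
    {T : V → Q → Prop} [∀ v, DecidablePred (T v)] (h : ∀ v, ∃ C, endpoints T C = {v})
    (S : Finset V) : ∃ C, endpoints T C = S := by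
  induction S using Finset.induction_on with
  | empty => exact ⟨∅, endpoints_empty T⟩
  | insert v S hv ih =>
    obtain ⟨A, hA⟩ := ih
    obtain ⟨B, hB⟩ := h v
    exact ⟨symmDiff A B, by rw [endpoints_symmDiff, hA, hB, insert_eq_symmDiff hv]⟩

lemma exists_endpoints_xAnc (S : Finset (XAnc d)) :
    ∃ C, endpoints (XAnc.Touches (d := d)) C = S := by
  refine exists_endpoints_eq (fun v => ?_) S
  -- The chain runs along the lattice row from the left boundary to the ancilla.
  let C : Finset (Qubit d) :=
    (Finset.univ.filter fun p : Fin d × Fin d => p.1 = v.1 ∧ p.2.val ≤ v.2.val).map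
      Function.Embedding.inl
  have hor_C : ∀ i j : ℕ, hor (chi C) i j = if i = v.1 ∧ j ≤ v.2.val then 1 else 0 := by
    intro i j
    have h1 := v.1.2
    have h2 := v.2.2
    simp only [hor, chi, C, Finset.mem_map, Finset.mem_filter, Finset.mem_univ, true_and,
      Function.Embedding.inl_apply, Sum.inl.injEq, exists_eq_right, Fin.ext_iff]
    split_ifs <;> first | rfl | omega
  have ver_C : ∀ b c : ℕ, ver (chi C) b c = 0 := by
    intro b c
    simp [ver, chi, C]
  refine ⟨C, (endpoints_eq_iff _).2 ?_⟩
  rintro ⟨i, c⟩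
  rw [bdX_eq, ver_C, ver_C, hor_C, hor_C]
  simp only [Finset.mem_singleton, Prod.ext_iff, Fin.ext_iff]
  split_ifs <;> first | omega | decide

lemma exists_endpoints_zAnc (S : Finset (ZAnc d)) :
    ∃ C, endpoints (ZAnc.Touches (d := d)) C = S := by
  obtain ⟨C, hC⟩ := exists_endpoints_xAnc (S.map (Equiv.prodComm _ _).toEmbedding)
  rw [endpoints_eq_iff] at hC
  refine ⟨C.map (transpose d).symm.toEmbedding, (endpoints_eq_iff _).2 fun a => ?_⟩
  have : (chi (C.map (transpose d).symm.toEmbedding)) ∘ (transpose d).symm = chi C := by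
    funext q; simp [chi]
  rw [bd_transpose, this, hC]
  simp

theorem exists_isDecoder :
    ∃ D : Syndrome d → Finset (Qubit d) × Finset (Qubit d), IsDecoder D := by
  have hX : ∀ (w : Qubit d → ℚ) S, ∃ E, IsMWPM (XAnc.Touches (d := d)) w S E := by
    intro w S
    refine exists_isMWPM w ?_
    rcases S.eq_empty_or_nonempty with rfl | hS
    · exact ⟨∅, isMatching_of_endpoints card_xAnc_touching _ _ (endpoints_empty _) fun _ => rfl⟩
    · obtain ⟨C, hC⟩ := exists_endpoints_xAnc S
      exact ⟨C, isMatching_of_endpoints card_xAnc_touching _ _ hC fun h => absurd h hS.ne_empty⟩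
  have hZ : ∀ (w : Qubit d → ℚ) S, ∃ E, IsMWPM (ZAnc.Touches (d := d)) w S E := by
    intro w S
    refine exists_isMWPM w ?_
    rcases S.eq_empty_or_nonempty with rfl | hS
    · exact ⟨∅, isMatching_of_endpoints card_zAnc_touching _ _ (endpoints_empty _) fun _ => rfl⟩
    · obtain ⟨C, hC⟩ := exists_endpoints_zAnc S
      exact ⟨C, isMatching_of_endpoints card_zAnc_touching _ _ hC fun h => absurd h hS.ne_empty⟩
  have : ∀ s : Syndrome d, ∃ E : Finset (Qubit d) × Finset (Qubit d), IsOutput s E.1 E.2 := by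
    intro s
    obtain ⟨z, hz⟩ := hX (updateWeights s) (Finset.univ.filter fun a => s (Sum.inl a) = 1)
    obtain ⟨x, hx⟩ := hZ (updateWeights s)
      (Finset.univ.filter fun a => flipSyndrome s z (Sum.inr a) = 1)
    exact ⟨(z, x), hz, hx⟩
  choose D hD using this
  exact ⟨D, hD⟩

/-! ### Syndromes of `Z` errors -/

/-- The restriction of a chain to the modified qubits. -/
def modPart (f : Qubit d → ZMod 2) : Qubit d → ZMod 2 := fun q => if Modified q then f q else 0

lemma measuresY_inl (a : XAnc d) (q : Qubit d) : ¬ MeasuresY (Sum.inl a) q := by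
  simp [MeasuresY, gen]

lemma measuresY_inr (a : ZAnc d) (q : Qubit d) :
    MeasuresY (Sum.inr a) q ↔ a.Touches q ∧ Modified q := by
  simp [MeasuresY, gen]

lemma syndrome_inl (e : Finset (Qubit d)) (a : XAnc d) :
    syndrome (toPauli e ∅) (Sum.inl a) = bd (XAnc.Touches (d := d)) (chi e) a := by
  simp only [syndrome, symp, gen, toPauli, bd, ind, chi, Pi.zero_apply, zero_mul, zero_add,
    ite_mul, one_mul]

lemma syndrome_inr (e : Finset (Qubit d)) (a : ZAnc d) :
    syndrome (toPauli e ∅) (Sum.inr a) = bd (ZAnc.Touches (d := d)) (modPart (chi e)) a := by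
  simp only [syndrome, symp, gen, toPauli, bd, ind, chi, modPart, Finset.notMem_empty, if_false,
    mul_zero, zero_add]
  refine Finset.sum_congr rfl fun q _ => ?_
  by_cases h1 : a.Touches q <;> by_cases h2 : Modified q <;> simp [h1, h2]

lemma flipSyndrome_inr (e z : Finset (Qubit d)) (a : ZAnc d) :
    flipSyndrome (syndrome (toPauli e ∅)) z (Sum.inr a) =
      bd (ZAnc.Touches (d := d)) (modPart (chi (symmDiff e z))) a := by
  have : modPart (chi (symmDiff e z)) = modPart (chi e) + modPart (chi z) := by
    funext q
    rw [chi_symmDiff]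
    simp only [modPart, Pi.add_apply]
    split_ifs <;> simp
  rw [this, bd_add, Pi.add_apply, flipSyndrome, syndrome_inr]
  congr 1
  rw [Finset.card_eq_sum_ones, Finset.sum_filter, Nat.cast_sum, bd]
  rw [← Finset.sum_subset (Finset.subset_univ z)]
  · refine Finset.sum_congr rfl fun q hq => ?_
    simp only [modPart, chi, hq, measuresY_inr, if_true]
    by_cases h1 : a.Touches q <;> by_cases h2 : Modified q <;> simp [h1, h2]
  · intro q _ hq
    simp [modPart, chi, hq]

/-- The two lattice-row qubits of a `B` generator share a column but lie in rows of opposite parity,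
and no column carries modified qubits of both parities. -/
lemma modified_unique (hd : 3 < d) {a : ZAnc d} {q q' : Qubit d} (h : a.Touches q)
    (h' : a.Touches q') (hm : Modified q) (hm' : Modified q') : q = q' := by
  rcases q with ⟨i, j⟩ | q
  · rcases q' with ⟨i', j'⟩ | q'
    · obtain ⟨hj, hi⟩ := h
      obtain ⟨hj', hi'⟩ := h'
      simp only [Modified] at hm hm'
      have hjj : j = j' := hj.trans hj'.symm
      subst hjj
      have : i = i' := by ext; omega
      rw [this]
    · exact hm'.elim
  · exact hm.elim

lemma exists_zAnc_touching (hd : 3 < d) {q : Qubit d} (hm : Modified q) :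
    ∃ a : ZAnc d, a.Touches q := by
  rcases q with ⟨i, j⟩ | q
  · have hi := i.2
    by_cases h : i.val < d - 1
    · exact ⟨(⟨i, h⟩, j), rfl, Or.inl rfl⟩
    · refine ⟨(⟨i - 1, by omega⟩, j), rfl, Or.inr ?_⟩
      simp only; omega
  · exact hm.elim

lemma exists_measuresY_iff (hd : 3 < d) (q : Qubit d) : (∃ a, MeasuresY a q) ↔ Modified q := by
  constructor
  · rintro ⟨a | a, h⟩
    · exact absurd h (measuresY_inl a q)
    · exact ((measuresY_inr a q).1 h).2
  · intro hm
    obtain ⟨a, ha⟩ := exists_zAnc_touching hd hm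
    exact ⟨Sum.inr a, (measuresY_inr a q).2 ⟨ha, hm⟩⟩

lemma syndrome_of_measuresY (hd : 3 < d) (e : Finset (Qubit d)) {a : Anc d} {q : Qubit d}
    (h : MeasuresY a q) : syndrome (toPauli e ∅) a = chi e q := by
  rcases a with a | a
  · exact absurd h (measuresY_inl a q)
  rw [measuresY_inr] at h
  rw [syndrome_inr, bd, Finset.sum_eq_single q]
  · rw [if_pos h.1, modPart, if_pos h.2]
  · intro q' _ hne
    by_cases h1 : a.Touches q'
    · by_cases h2 : Modified q'
      · exact absurd (modified_unique hd h1 h.1 h2 h.2) hne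
      · simp [modPart, h2]
    · simp [h1]
  · simp

/-! ### The weights for the syndrome of a `Z` error -/

/-- The order of the updates is immaterial as soon as all generators acting on `b` assign the same
value. -/
lemma foldl_update {α β γ : Type} (l : List α) (P : α → β → Prop) [∀ a b, Decidable (P a b)]
    (g : α → γ) (w : β → γ) (b : β) (c : γ) (h : ∀ a ∈ l, P a b → g a = c) :
    (∃ a ∈ l, P a b) ∨ w b = c →
      l.foldl (fun w a b => if P a b then g a else w b) w b = c := by
  induction l generalizing w with
  | nil => simp
  | cons a l ih =>
    intro h'
    rw [List.foldl_cons]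
    refine ih _ (fun a' ha' => h a' (List.mem_cons_of_mem _ ha')) ?_
    by_cases ha : P a b
    · right
      rw [if_pos ha]; exact h a List.mem_cons_self ha
    · rw [if_neg ha]
      refine h'.imp_left ?_
      rintro ⟨a', ha', hP⟩
      rcases List.mem_cons.1 ha' with rfl | ha'
      · exact absurd hP ha
      · exact ⟨a', ha', hP⟩

lemma mem_zyList {a : Anc d} {q : Qubit d} (h : MeasuresY a q) : a ∈ zyList d := by
  rcases a with a | a
  · exact absurd h (measuresY_inl a q)
  · simp only [zyList, List.mem_filter, List.mem_flatMap, List.mem_map, List.mem_finRange, true_and,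
      decide_eq_true_eq]
    exact ⟨⟨a.1, a.2, rfl⟩, q, h⟩

lemma firstWeights_eq (hd : 3 < d) (e : Finset (Qubit d)) (q : Qubit d) :
    firstWeights (syndrome (toPauli e ∅)) q =
      if Modified q then (if q ∈ e then 9 / 10 else 11 / 10) else 1 := by
  refine foldl_update (zyList d) MeasuresY
    (fun a => if syndrome (toPauli e ∅) a = 1 then (9 / 10 : ℚ) else 11 / 10) _ q _ ?_ ?_
  · intro a _ ha
    have hm : Modified q := (exists_measuresY_iff hd q).1 ⟨a, ha⟩
    simp only [syndrome_of_measuresY hd e ha, chi_eq_one, if_pos hm]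
  · by_cases hm : Modified q
    · obtain ⟨a, ha⟩ := (exists_measuresY_iff hd q).2 hm
      exact Or.inl ⟨a, mem_zyList ha, ha⟩
    · exact Or.inr (by simp [hm])

variable {e : Finset (Qubit d)} {q : Qubit d}

lemma weight_of_not_modified (hd : 3 < d) (hm : ¬ Modified q) :
    updateWeights (syndrome (toPauli e ∅)) q = 1 := by
  rw [updateWeights, if_neg, firstWeights_eq hd, if_neg hm]
  rintro ⟨a, -, ha⟩
  exact hm ((exists_measuresY_iff hd q).1 ⟨a, ha⟩)

lemma weight_of_notMem (hd : 3 < d) (hm : Modified q) (hq : q ∉ e) :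
    updateWeights (syndrome (toPauli e ∅)) q = 11 / 10 := by
  rw [updateWeights, if_neg, firstWeights_eq hd, if_pos hm, if_neg hq]
  rintro ⟨a, h, ha⟩
  have := h.1
  rw [syndrome_of_measuresY hd e ha, chi_eq_one] at this
  exact hq this

lemma weight_of_mem (hd : 3 < d) (hm : Modified q) (hq : q ∈ e) :
    updateWeights (syndrome (toPauli e ∅)) q = 9 / 10 ∨
      updateWeights (syndrome (toPauli e ∅)) q = -1 / 10 := by
  rw [updateWeights, firstWeights_eq hd, if_pos hm, if_pos hq]
  split_ifs
  · exact Or.inr rfl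
  · exact Or.inl rfl

/-- Applied to errors inside a single lattice row, which switch on no `X` ancilla in the adjacent
rows. -/
lemma weight_of_isolated (hd : 3 < d) (hm : Modified q) (hq : q ∈ e)
    (h : ∀ b : XAnc d, AdjacentRow b q → bd (XAnc.Touches (d := d)) (chi e) b = 0) :
    updateWeights (syndrome (toPauli e ∅)) q = -1 / 10 := by
  obtain ⟨a, ha⟩ := (exists_measuresY_iff hd q).2 hm
  rw [updateWeights, if_pos]
  exact ⟨a, ⟨by rw [syndrome_of_measuresY hd e ha, chi_eq_one]; exact hq, q, ha,
    fun b hb => by rw [syndrome_inl]; exact h b hb⟩, ha⟩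

lemma one_le_weight (hd : 3 < d) (hq : q ∉ e) : 1 ≤ updateWeights (syndrome (toPauli e ∅)) q := by
  by_cases hm : Modified q
  · rw [weight_of_notMem hd hm hq]; norm_num
  · rw [weight_of_not_modified hd hm]

lemma weight_le_one (hd : 3 < d) (hq : q ∈ e) : updateWeights (syndrome (toPauli e ∅)) q ≤ 1 := by
  by_cases hm : Modified q
  · rcases weight_of_mem hd hm hq with h | h <;> rw [h] <;> norm_num
  · rw [weight_of_not_modified hd hm]

lemma weight_lt_one (hd : 3 < d) (hm : Modified q) (hq : q ∈ e) :
    updateWeights (syndrome (toPauli e ∅)) q < 1 := by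
  rcases weight_of_mem hd hm hq with h | h <;> rw [h] <;> norm_num

lemma weight_ge (hd : 3 < d) : -1 / 10 ≤ updateWeights (syndrome (toPauli e ∅)) q := by
  by_cases hm : Modified q
  · by_cases hq : q ∈ e
    · rcases weight_of_mem hd hm hq with h | h <;> rw [h]; norm_num
    · rw [weight_of_notMem hd hm hq]; norm_num
  · rw [weight_of_not_modified hd hm]; norm_num

lemma weight_le (hd : 3 < d) : updateWeights (syndrome (toPauli e ∅)) q ≤ 11 / 10 := by
  by_cases hq : q ∈ e
  · exact (weight_le_one hd hq).trans (by norm_num)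
  · by_cases hm : Modified q
    · rw [weight_of_notMem hd hm hq]
    · rw [weight_of_not_modified hd hm]; norm_num

end Decoding

/-! ### Row profiles of cycles in the lattice -/

section Profile

variable {d : ℕ}

/-- The number of the lattice row of a qubit; the qubits of an intermediate row are counted with the
lattice row below them. -/
def cell : Qubit d → ℕ
  | Sum.inl (i, _) => i
  | Sum.inr (b, _) => b + 1

/-- The number of elements of `L` in lattice row `i`. -/
def rowCount (L : Finset (Qubit d)) (i : ℕ) : ℕ := (L.filter fun q => q.isLeft ∧ cell q = i).card

/-- The number of modified elements of `L` in lattice row `i`. -/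
def modCount (L : Finset (Qubit d)) (i : ℕ) : ℕ := (L.filter fun q => Modified q ∧ cell q = i).card

/-- The number of elements of `L` in the intermediate row above lattice row `b`. -/
def verCount (L : Finset (Qubit d)) (b : ℕ) : ℕ := (L.filter fun q => ¬ q.isLeft ∧ cell q = b).card

lemma Modified.isLeft {q : Qubit d} (h : Modified q) : q.isLeft := by
  rcases q with q | q
  · rfl
  · exact h.elim

lemma modCount_le (L : Finset (Qubit d)) (i : ℕ) : modCount L i ≤ rowCount L i :=
  Finset.card_le_card fun q hq => by
    simp only [Finset.mem_filter] at hq ⊢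
    exact ⟨hq.1, hq.2.1.isLeft, hq.2.2⟩

lemma rowCount_add_verCount (L : Finset (Qubit d)) (i : ℕ) :
    rowCount L i + verCount L i = (L.filter fun q => cell q = i).card := by
  rw [← Finset.card_filter_add_card_filter_not (s := L.filter fun q => cell q = i)
    (fun q => q.isLeft = true), Finset.filter_filter, Finset.filter_filter]
  simp only [rowCount, verCount, and_comm]

lemma verCount_zero (L : Finset (Qubit d)) : verCount L 0 = 0 := by
  rw [verCount, Finset.card_eq_zero, Finset.filter_eq_empty_iff]
  rintro (q | q) - <;> simp [cell]

lemma verCount_top (L : Finset (Qubit d)) : verCount L d = 0 := by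
  rw [verCount, Finset.card_eq_zero, Finset.filter_eq_empty_iff]
  rintro (q | ⟨b, c⟩) -
  · simp
  · have := b.2
    simp only [Sum.isLeft_inr, cell]
    omega

lemma card_filter_eq_sum (L : Finset (Qubit d)) (P : Qubit d → Prop) [DecidablePred P] :
    ((L.filter P).card : ZMod 2) = ∑ q, if P q then chi L q else 0 :=
  (bd_chi (fun (_ : Unit) q => P q) L ()).symm

lemma rowCount_cast (L : Finset (Qubit d)) {i : ℕ} (hi : i < d) :
    (rowCount L i : ZMod 2) = rowSum (chi L) i := by
  rw [rowCount, card_filter_eq_sum, Fintype.sum_sum_type, Fintype.sum_prod_type,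
    Finset.sum_eq_single ⟨i, hi⟩, rowSum, Finset.sum_range]
  · simp only [Sum.isLeft_inr, Bool.false_eq_true, false_and, if_false, Finset.sum_const_zero,
      add_zero]
    refine Finset.sum_congr rfl fun j _ => ?_
    rw [if_pos ⟨rfl, rfl⟩]
    exact (hor_fin (chi L) ⟨i, hi⟩ j).symm
  · intro i' _ hne
    refine Finset.sum_eq_zero fun j _ => if_neg fun h => hne (Fin.ext h.2)
  · simp

lemma verCount_cast (L : Finset (Qubit d)) (b : ℕ) :
    (verCount L b : ZMod 2) = ∑ c ∈ Finset.range (d - 1), ver (chi L) b c := by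
  by_cases hb : 0 < b ∧ b - 1 < d - 1
  · rw [verCount, card_filter_eq_sum, Fintype.sum_sum_type]
    simp only [Sum.isLeft_inl, not_true_eq_false, false_and, if_false, Finset.sum_const_zero,
      zero_add]
    rw [Fintype.sum_prod_type, Finset.sum_eq_single ⟨b - 1, hb.2⟩, Finset.sum_range]
    · refine Finset.sum_congr rfl fun j _ => ?_
      rw [if_pos ⟨by simp, by simp only [cell]; omega⟩, ver, dif_pos ⟨hb.1, hb.2, j.2⟩]
    · intro i' _ hne
      refine Finset.sum_eq_zero fun j _ => if_neg fun h => hne (Fin.ext ?_)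
      have := h.2
      simp only [cell] at this ⊢
      omega
    · simp
  · rw [verCount, (Finset.card_eq_zero).2, Finset.sum_eq_zero]
    · simp
    · intro c _
      rw [ver, dif_neg]; tauto
    · rw [Finset.filter_eq_empty_iff]
      rintro (q | ⟨b', c⟩) -
      · simp
      · have := b'.2
        simp only [Sum.isLeft_inr, cell]
        omega

lemma ver_eq_zero {L : Finset (Qubit d)} {b : ℕ} (h : verCount L b = 0) (c : ℕ) :
    ver (chi L) b c = 0 := by
  rw [ver]
  split_ifs with hb
  · rw [verCount, Finset.card_eq_zero, Finset.filter_eq_empty_iff] at h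
    rw [chi_eq_zero]
    intro hmem
    refine h hmem ⟨by simp, ?_⟩
    simp only [cell]; omega
  · rfl

/-- The sum of the `X` ancilla equations along a lattice row. -/
lemma hor_ends {L : Finset (Qubit d)} (h : XCycle (chi L)) {i : ℕ} (hi : i < d) :
    hor (chi L) i 0 + hor (chi L) i (d - 1) = ((verCount L i + verCount L (i + 1) : ℕ) : ZMod 2) := by
  rw [Nat.cast_add, verCount_cast, verCount_cast, ← Finset.sum_add_distrib]
  have : ∀ n ≤ d - 1, hor (chi L) i 0 + hor (chi L) i n =
      ∑ c ∈ Finset.range n, (ver (chi L) i c + ver (chi L) (i + 1) c) := by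
    intro n
    induction n with
    | zero => intro _; simpa using zmod_two_add_self _
    | succ n ih =>
      intro hn
      rw [Finset.sum_range_succ, ← ih (by omega), ← zmod_two_eq_of_add (h.eq hi (by omega))]
      generalize hor (chi L) i 0 = x
      generalize hor (chi L) i n = y
      generalize hor (chi L) i (n + 1) = z
      revert x y z; decide
  exact this _ le_rfl

lemma exists_unique_of_counts {L : Finset (Qubit d)} {i : ℕ} (h1 : rowCount L i = 1)
    (h2 : modCount L i = 1) :
    ∃ j₀ : Fin d, ((i % 2 = 0 ∧ (j₀.val = 0 ∨ j₀.val + 1 = d)) ∨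
      (i % 2 = 1 ∧ (j₀.val = 1 ∨ j₀.val + 2 = d))) ∧
      ∀ j, hor (chi L) i j = if j = j₀ then 1 else 0 := by
  obtain ⟨q, hq⟩ := Finset.card_eq_one.1 h1
  obtain ⟨q', hq'⟩ := Finset.card_eq_one.1 h2
  have hmem' : q' ∈ L ∧ Modified q' ∧ cell q' = i := by
    simpa using (Finset.ext_iff.1 hq' q').2 (Finset.mem_singleton_self _)
  have hqq : q' = q := by
    have : q' ∈ ({q} : Finset (Qubit d)) := by
      rw [← hq]; simp only [Finset.mem_filter]
      exact ⟨hmem'.1, hmem'.2.1.isLeft, hmem'.2.2⟩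
    simpa using this
  subst hqq
  rcases q' with ⟨i', j₀⟩ | q'
  · obtain ⟨hL, hm, hc⟩ := hmem'
    simp only [cell] at hc
    subst hc
    refine ⟨j₀, hm, fun j => ?_⟩
    split_ifs with hj
    · rw [hj, hor_fin, chi_eq_one]; exact hL
    · rw [hor]
      split_ifs with hj'
      · rw [chi_eq_zero]
        intro hmem
        have : (Sum.inl (i', ⟨j, hj'.2⟩) : Qubit d) ∈ ({Sum.inl (i', j₀)} : Finset (Qubit d)) := by
          rw [← hq]; simp only [Finset.mem_filter]
          exact ⟨hmem, rfl, rfl⟩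
        simp only [Finset.mem_singleton, Sum.inl.injEq, Prod.mk.injEq, true_and] at this
        exact hj (congrArg Fin.val this)
      · rfl
  · exact hmem'.2.1.elim

/-- The parity conditions come from `hor_ends`: a single modified qubit is at an end of an even row
and in the interior of an odd row. The length condition comes from column sums, which are constant
between empty intermediate rows. -/
lemma isRowProfile (hd : 3 < d) (hodd : Odd d) {L : Finset (Qubit d)} (h : XCycle (chi L)) :
    IsRowProfile d (rowCount L) (modCount L) (verCount L) where
  le := modCount_le L
  even_row i hi hi2 h1 h2 := by
    obtain ⟨j₀, hj, hh⟩ := exists_unique_of_counts h1 h2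
    have := hor_ends h hi
    rw [hh, hh] at this
    rw [← Nat.odd_iff, ← ZMod.natCast_eq_one_iff_odd, ← this]
    have := j₀.2
    split_ifs <;> first | rfl | omega
  odd_row i hi hi2 h1 h2 := by
    obtain ⟨j₀, hj, hh⟩ := exists_unique_of_counts h1 h2
    have := hor_ends h hi
    rw [hh, hh] at this
    rw [← Nat.even_iff, ← ZMod.natCast_eq_zero_iff_even, ← this]
    have := j₀.2
    split_ifs <;> first | rfl | omega
  even_length p q hpq hq hp0 hq0 hone := by
    have hconst : ∀ j < d, ∑ i ∈ Finset.Ico p q, hor (chi L) i j =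
        ∑ i ∈ Finset.Ico p q, hor (chi L) i 0 := by
      intro j
      induction j with
      | zero => intro _; rfl
      | succ j ih =>
        intro hj
        rw [← ih (by omega)]
        have e1 := ver_eq_sum h (c := j) (by omega) hq
        have e2 := ver_eq_sum h (c := j) (by omega) (hpq.le.trans hq)
        rw [ver_eq_zero hq0, ← Finset.sum_range_add_sum_Ico _ hpq.le,
          ← Finset.sum_range_add_sum_Ico (fun i => hor (chi L) i (j + 1)) hpq.le] at e1
        rw [ver_eq_zero hp0] at e2
        have e2 := zmod_two_eq_of_add e2
        have e1 := zmod_two_eq_of_add e1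
        rw [e2] at e1
        exact (add_left_cancel e1).symm
    have hzero : ∀ j < d, ∑ i ∈ Finset.Ico p q, hor (chi L) i j = 0 := by
      intro j hj
      -- Column 2 contains no modified qubit because `d ≥ 5`, so all columns of the piece are even,
      -- and so is its number of qubits, one per row.
      rw [hconst j hj, ← hconst 2 (by omega)]
      refine Finset.sum_eq_zero fun i hi => ?_
      rw [Finset.mem_Ico] at hi
      obtain ⟨j₀, hj, hh⟩ := exists_unique_of_counts (hone i hi.1 hi.2).1 (hone i hi.1 hi.2).2
      obtain ⟨m, rfl⟩ := hodd
      rw [hh, if_neg (by omega)]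
    have hsum : ((q - p : ℕ) : ZMod 2) = 0 := by
      have h1 : ∑ i ∈ Finset.Ico p q, rowSum (chi L) i = 0 := by
        unfold rowSum
        rw [Finset.sum_comm]
        exact Finset.sum_eq_zero fun j hj => hzero j (by simpa using hj)
      rw [← h1, ← Nat.card_Ico, Finset.card_eq_sum_ones, Nat.cast_sum]
      refine Finset.sum_congr rfl fun i hi => ?_
      rw [Finset.mem_Ico] at hi
      rw [← rowCount_cast L (by omega), (hone i hi.1 hi.2).1]
    rwa [ZMod.natCast_eq_zero_iff_even, Nat.even_iff] at hsum

/-- Empty intermediate rows cut a cycle into cycles. -/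
lemma XCycle.cut {L : Finset (Qubit d)} (h : XCycle (chi L)) {p q : ℕ}
    (hp0 : verCount L p = 0) (hq0 : verCount L q = 0) :
    XCycle (chi (L.filter fun x => cell x ∈ Finset.Ico p q)) := by
  set C := L.filter fun x => cell x ∈ Finset.Ico p q with hC
  have hhor : ∀ i j, hor (chi C) i j = if p ≤ i ∧ i < q then hor (chi L) i j else 0 := by
    intro i j
    simp only [hor, chi, hC, Finset.mem_filter, cell, Finset.mem_Ico]
    split_ifs <;> first | rfl | tauto
  have hver : ∀ i j, ver (chi C) i j = if p ≤ i ∧ i < q then ver (chi L) i j else 0 := by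
    intro i j
    simp only [ver, chi, hC, Finset.mem_filter, cell, Finset.mem_Ico]
    by_cases hb : 0 < i ∧ i - 1 < d - 1 ∧ j < d - 1
    · have : i - 1 + 1 = i := by omega
      simp only [this, dif_pos hb]
      split_ifs <;> first | rfl | tauto
    · simp [dif_neg hb]
  rintro ⟨i, c⟩
  have h0 := h (i, c)
  rw [bdX_eq] at h0
  rw [bdX_eq, hhor, hhor, hver, hver]
  by_cases h1 : p ≤ i.val ∧ i.val < q
  · rw [if_pos h1, if_pos h1, if_pos h1]
    by_cases h2 : i.val + 1 < q
    · rwa [if_pos (by omega)]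
    · rw [show i.val + 1 = q by omega, ver_eq_zero hq0] at h0
      rwa [if_neg (by omega)]
  · rw [if_neg h1, if_neg h1, if_neg h1, add_zero, zero_add, zero_add]
    split_ifs with h2
    · have : i.val + 1 = p := by omega
      rw [this, ver_eq_zero hp0]
    · rfl

end Profile

open Finset

/-! ### Exchanging a matching along a cycle -/

section Exchange

variable {V Q : Type} [Fintype V] [DecidableEq V] [Fintype Q] [DecidableEq Q]
  {T : V → Q → Prop} [∀ v, DecidablePred (T v)]

/-- Adding a cycle does not decrease the weight of a minimum weight perfect matching. -/
lemma IsMWPM.exchange (hT : ∀ q, (univ.filter fun v => T v q).card ≤ 2) {w : Q → ℚ}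
    {S : Finset V} {E C : Finset Q} (h : IsMWPM T w S E) (hS : S ≠ ∅) (hC : endpoints T C = ∅) :
    ∑ q ∈ C with q ∈ E, w q ≤ ∑ q ∈ C with q ∉ E, w q := by
  have h1 := h.le_of_bd hT hS (E' := symmDiff E C) (by
    rw [endpoints_symmDiff, hC, h.1.endpoints_eq]; exact symmDiff_bot S)
  have h2 : E = (C.filter fun q => q ∈ E) ∪ (E \ C) := by
    ext q; simp only [mem_union, mem_filter, mem_sdiff]; tauto
  have h3 : symmDiff E C = (C.filter fun q => q ∉ E) ∪ (E \ C) := by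
    ext q; simp only [mem_union, mem_filter, mem_sdiff, mem_symmDiff]; tauto
  have h4 : ∑ q ∈ E, w q = ∑ q ∈ C with q ∈ E, w q + ∑ q ∈ E \ C, w q := by
    conv_lhs => rw [h2]
    refine sum_union (disjoint_left.2 fun q => ?_)
    simp only [mem_filter, mem_sdiff]; tauto
  rw [h3, h4, sum_union (disjoint_left.2 fun q => by
    simp only [mem_filter, mem_sdiff]; tauto)] at h1
  linarith

end Exchange

/-! ### Consequences of minimality for the decoder output -/

section Output

variable {d : ℕ} {e z x : Finset (Qubit d)}

lemma xCycle_iff {C : Finset (Qubit d)} :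
    XCycle (chi C) ↔ endpoints (XAnc.Touches (d := d)) C = ∅ := by
  rw [endpoints_eq_iff]; simp [XCycle]

lemma zCycle_iff {C : Finset (Qubit d)} :
    ZCycle (chi C) ↔ endpoints (ZAnc.Touches (d := d)) C = ∅ := by
  rw [endpoints_eq_iff]; simp [ZCycle]

lemma switchedOn_eq (e : Finset (Qubit d)) :
    (univ.filter fun a : XAnc d => syndrome (toPauli e ∅) (Sum.inl a) = 1) =
      endpoints (XAnc.Touches (d := d)) e := by
  ext a; simp [mem_endpoints, syndrome_inl]

lemma chi_filter_modified (L : Finset (Qubit d)) : chi (L.filter Modified) = modPart (chi L) := by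
  funext q
  simp only [chi, modPart, mem_filter]
  split_ifs <;> tauto

lemma switchedOn_flip_eq (e z : Finset (Qubit d)) :
    (univ.filter fun a : ZAnc d => flipSyndrome (syndrome (toPauli e ∅)) z (Sum.inr a) = 1) =
      endpoints (ZAnc.Touches (d := d)) ((symmDiff e z).filter Modified) := by
  ext a; simp [mem_endpoints, flipSyndrome_inr, chi_filter_modified]

lemma IsOutput.xCycle (h : IsOutput (syndrome (toPauli e ∅)) z x) :
    XCycle (chi (symmDiff e z)) := by
  have := h.1.1.endpoints_eq
  rw [switchedOn_eq] at this
  rw [xCycle_iff, endpoints_symmDiff, this]; exact symmDiff_self _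

lemma IsOutput.zCycle (h : IsOutput (syndrome (toPauli e ∅)) z x) :
    ZCycle (chi (symmDiff x ((symmDiff e z).filter Modified))) := by
  have := h.2.1.endpoints_eq
  rw [switchedOn_flip_eq] at this
  rw [zCycle_iff, endpoints_symmDiff, this]; exact symmDiff_self _

/-- A cycle composed of errors and estimated errors does not weigh less on the errors. -/
lemma IsOutput.xWeight_le (h : IsOutput (syndrome (toPauli e ∅)) z x) {C : Finset (Qubit d)}
    (hC : XCycle (chi C)) (hCL : C ⊆ symmDiff e z) :
    z = ∅ ∨ ∑ q ∈ C with q ∉ e, updateWeights (syndrome (toPauli e ∅)) q ≤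
      ∑ q ∈ C with q ∈ e, updateWeights (syndrome (toPauli e ∅)) q := by
  by_cases hS : (univ.filter fun a : XAnc d => syndrome (toPauli e ∅) (Sum.inl a) = 1) = ∅
  -- With nothing switched on the matching is forced to be empty, so minimality cannot be tested
  -- against cycles; qubits of negative weight do not matter here.
  · left
    have := h.1.1
    rw [hS] at this
    exact this.eq_empty
  · right
    have := h.1.exchange card_xAnc_touching hS (xCycle_iff.1 hC)
    have h1 : (C.filter fun q => q ∉ e) = C.filter fun q => q ∈ z := by
      refine filter_congr fun q hq => ?_
      have := hCL hq
      rw [mem_symmDiff] at this; tauto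
    have h2 : (C.filter fun q => q ∈ e) = C.filter fun q => q ∉ z := by
      refine filter_congr fun q hq => ?_
      have := hCL hq
      rw [mem_symmDiff] at this; tauto
    rw [h1, h2]; exact this

lemma IsOutput.card_le (hd : 3 < d) (h : IsOutput (syndrome (toPauli e ∅)) z x)
    {C : Finset (Qubit d)} (hC : XCycle (chi C)) (hCL : C ⊆ symmDiff e z) :
    (C.filter fun q => q ∉ e).card ≤ (C.filter fun q => q ∈ e).card ∧
    ((∃ q ∈ C, Modified q) →
      (C.filter fun q => q ∉ e).card < (C.filter fun q => q ∈ e).card) := by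
  rcases h.xWeight_le hC hCL with rfl | hw
  · have hCe : ∀ q ∈ C, q ∈ e := fun q hq => by simpa [mem_symmDiff] using hCL hq
    rw [filter_true_of_mem hCe, filter_false_of_mem (fun q hq => not_not.2 (hCe q hq)), card_empty]
    exact ⟨Nat.zero_le _, fun ⟨q, hq, _⟩ => card_pos.2 ⟨q, hq⟩⟩
  · have h1 : ((C.filter fun q => q ∉ e).card : ℚ) ≤
        ∑ q ∈ C with q ∉ e, updateWeights (syndrome (toPauli e ∅)) q := by
      rw [card_eq_sum_ones, Nat.cast_sum]
      refine sum_le_sum fun q hq => ?_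
      simpa using one_le_weight hd (mem_filter.1 hq).2
    have h2 : ∑ q ∈ C with q ∈ e, updateWeights (syndrome (toPauli e ∅)) q ≤
        ((C.filter fun q => q ∈ e).card : ℚ) := by
      rw [card_eq_sum_ones, Nat.cast_sum]
      refine sum_le_sum fun q hq => ?_
      simpa using weight_le_one hd (mem_filter.1 hq).2
    refine ⟨by exact_mod_cast h1.trans (hw.trans h2), ?_⟩
    rintro ⟨q, hq, hm⟩
    by_cases hqe : q ∈ e
    · have h3 : ∑ q ∈ C with q ∈ e, updateWeights (syndrome (toPauli e ∅)) q <
          ((C.filter fun q => q ∈ e).card : ℚ) := by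
        rw [card_eq_sum_ones, Nat.cast_sum]
        refine sum_lt_sum (fun q hq => ?_) ⟨q, by simp [hq, hqe], ?_⟩
        · simpa using weight_le_one hd (mem_filter.1 hq).2
        · simpa using weight_lt_one hd hm hqe
      exact_mod_cast h1.trans_lt (hw.trans_lt h3)
    · have h3 : ((C.filter fun q => q ∉ e).card : ℚ) <
          ∑ q ∈ C with q ∉ e, updateWeights (syndrome (toPauli e ∅)) q := by
        rw [card_eq_sum_ones, Nat.cast_sum]
        refine sum_lt_sum (fun q hq => ?_) ⟨q, by simp [hq, hqe], ?_⟩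
        · simpa using one_le_weight hd (mem_filter.1 hq).2
        · rw [weight_of_notMem hd hm hqe]; norm_num
      exact_mod_cast h3.trans_le (hw.trans h2)

/-! ### The estimate of the `Z` errors -/

lemma exists_of_colSum {L : Finset (Qubit d)} {j : ℕ} (hj : j < d) (h : colSum (chi L) j = 1) :
    ∃ i : Fin d, Sum.inl (i, ⟨j, hj⟩) ∈ L := by
  obtain ⟨i, hi, hne⟩ := exists_ne_zero_of_sum_ne_zero (h.trans_ne one_ne_zero)
  refine ⟨⟨i, by simpa using hi⟩, ?_⟩
  rw [hor, dif_pos ⟨by simpa using hi, hj⟩] at hne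
  exact chi_eq_one.1 ((zmod_two_cases _).resolve_left hne)

lemma le_card_left {L : Finset (Qubit d)} (h : ∀ j < d, colSum (chi L) j = 1) :
    d ≤ (L.filter fun q => q.isLeft).card := by
  choose f hf using fun j : Fin d => exists_of_colSum j.2 (h j j.2)
  have := card_le_card_of_injOn (s := (univ : Finset (Fin d)))
    (t := L.filter fun q => q.isLeft) (fun j => Sum.inl (f j, j))
    (fun j _ => by simpa using hf j) (fun j _ j' _ hjj => (Prod.mk.inj (Sum.inl.inj hjj)).2)
  simpa using this

lemma card_row_le {L : Finset (Qubit d)} {s : Finset (Fin d)}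
    (h : ∀ i ∈ s, ∀ j, Sum.inl (i, j) ∈ L) : s.card * d ≤ L.card := by
  have := card_le_card_of_injOn (s := s ×ˢ (univ : Finset (Fin d))) (t := L) Sum.inl
    (fun p hp => h _ (by simpa using hp) _) Sum.inl_injective.injOn
  simpa using this

lemma card_filter_left_add (L : Finset (Qubit d)) :
    (L.filter fun q => q.isLeft).card + (L.filter fun q => ¬ q.isLeft).card = L.card :=
  card_filter_add_card_filter_not _

/-- A cycle with a single qubit outside the lattice rows contains a modified qubit. -/
lemma XCycle.exists_modified {L : Finset (Qubit d)} (h : XCycle (chi L))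
    (h1 : (L.filter fun q => ¬ q.isLeft).card = 1) : ∃ q ∈ L, Modified q := by
  obtain ⟨q, hq⟩ := card_eq_one.1 h1
  have hver : ∀ b, verCount L b = if cell q = b then 1 else 0 := by
    intro b
    rw [verCount, ← filter_filter, hq, filter_singleton]
    split_ifs <;> rfl
  have hqL : q ∈ L ∧ ¬ q.isLeft := by
    simpa using (Finset.ext_iff.1 hq q).2 (mem_singleton_self _)
  rcases q with q | ⟨b, c⟩
  · exact absurd rfl hqL.2
  have hb := b.2
  -- One of the two lattice rows next to the intermediate qubit is even. By parity exactly one of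
  -- its ends lies in the cycle, and these ends are modified.
  obtain ⟨i, hi, hi2, hib⟩ : ∃ i < d, i % 2 = 0 ∧ (i = b.val ∨ i = b.val + 1) := by
    rcases Nat.mod_two_eq_zero_or_one b.val with h2 | h2
    · exact ⟨b, by omega, h2, Or.inl rfl⟩
    · exact ⟨b + 1, by omega, by omega, Or.inr rfl⟩
  have hends := hor_ends h hi
  have : verCount L i + verCount L (i + 1) = 1 := by
    rw [hver, hver]
    rcases hib with rfl | rfl <;> simp [cell]
  rw [this, Nat.cast_one] at hends
  have hmem : ∀ j (hj : j < d), hor (chi L) i j = 1 → Sum.inl (⟨i, hi⟩, ⟨j, hj⟩) ∈ L := by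
    intro j hj hij
    rw [hor, dif_pos ⟨hi, hj⟩] at hij
    exact chi_eq_one.1 hij
  rcases zmod_two_cases (hor (chi L) i 0) with h0 | h0
  · rw [h0, zero_add] at hends
    exact ⟨_, hmem (d - 1) (by omega) hends, Or.inl ⟨hi2, Or.inr (by simp only; omega)⟩⟩
  · exact ⟨_, hmem 0 (by omega) h0, Or.inl ⟨hi2, Or.inl rfl⟩⟩

/-- A cycle without qubits outside the lattice rows is a union of lattice rows. -/
lemma XCycle.row_const {L : Finset (Qubit d)} (h : XCycle (chi L))
    (h0 : (L.filter fun q => ¬ q.isLeft).card = 0) {i j : Fin d} (hij : Sum.inl (i, j) ∈ L)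
    (j' : Fin d) : Sum.inl (i, j') ∈ L := by
  have hver : ∀ b c, ver (chi L) b c = 0 := by
    intro b c
    refine ver_eq_zero ?_ c
    rw [verCount, ← filter_filter, card_eq_zero.1 h0, filter_empty, card_empty]
  have hconst : ∀ n < d, hor (chi L) i n = hor (chi L) i 0 := by
    intro n
    induction n with
    | zero => intro _; rfl
    | succ n ih =>
      intro hn
      have := h.eq i.2 (c := n) (by omega)
      rw [hver, hver, add_zero, add_zero] at this
      rw [← ih (by omega)]; exact (zmod_two_eq_of_add this).symm
  rw [← chi_eq_one, ← hor_fin (chi L) i j', hconst _ j'.2, ← hconst _ j.2, hor_fin, chi_eq_one]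
  exact hij

/-- A nontrivial `L` is so short that it must be a single lattice row containing `e`; a modified
error in that row then contradicts minimality. -/
lemma IsOutput.colSum_eq_zero (hd : 3 < d) {t : ℕ} (hdt : d = 2 * t + 1) (he : e.card = t + 1)
    (hrow : ¬ ∃ i : Fin d, ∀ q ∈ e, (∃ j : Fin d, q = Sum.inl (i, j)) ∧ ¬ Modified q)
    (h : IsOutput (syndrome (toPauli e ∅)) z x) : colSum (chi (symmDiff e z)) 0 = 0 := by
  by_contra hcol
  have hcyc := h.xCycle
  set L := symmDiff e z with hL
  have hcol : ∀ j < d, colSum (chi L) j = 1 := fun j hj => by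
    rw [colSum_const hcyc hj]; exact (zmod_two_cases _).resolve_left hcol
  have hleft := le_card_left hcol
  have hlr := card_filter_left_add L
  have hin : (L.filter fun q => q ∈ e).card + (L.filter fun q => q ∉ e).card = L.card :=
    card_filter_add_card_filter_not _
  obtain ⟨hle, hlt⟩ := h.card_le hd hcyc Subset.rfl
  have hsub : (L.filter fun q => q ∈ e) ⊆ e := fun q hq => (mem_filter.1 hq).2
  have hsubc := card_le_card hsub
  -- `L` has at least `2t + 1` qubits, at least half of them errors, and there are only `t + 1`
  -- errors.
  have heq : (L.filter fun q => q ∈ e) = e := eq_of_subset_of_card_le hsub (by omega)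
  have heL : e ⊆ L := fun q hq => (mem_filter.1 (heq.symm ▸ hq : q ∈ L.filter fun q => q ∈ e)).1
  -- Since `|L| ≤ d + 1`, there is at most one qubit outside the lattice rows. It would force a
  -- modified qubit, hence the strict inequality and `|L| ≤ d`, leaving no room for it.
  have hright : (L.filter fun q => ¬ q.isLeft).card = 0 := by
    by_contra hne
    have := hlt (hcyc.exists_modified (by omega))
    omega
  obtain ⟨i, hi⟩ := exists_of_colSum (by omega) (hcol 0 (by omega))
  have herow : ∀ q ∈ e, ∃ j : Fin d, q = Sum.inl (i, j) := by
    intro q hq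
    rcases q with ⟨i', j⟩ | q
    · by_cases hii : i' = i
      · exact ⟨j, by rw [hii]⟩
      · have := card_row_le (L := L) (s := {i', i}) (by
          intro k hk j'
          simp only [mem_insert, mem_singleton] at hk
          rcases hk with rfl | rfl
          · exact hcyc.row_const hright (heL hq) j'
          · exact hcyc.row_const hright hi j')
        rw [card_pair hii] at this
        omega
    · rw [card_eq_zero] at hright
      exact absurd (show Sum.inr q ∈ L.filter fun q => ¬ q.isLeft by simpa using heL hq)
        (by rw [hright]; simp)
  push Not at hrow
  obtain ⟨q, hq, hqm⟩ := hrow i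
  have hqm := hqm (herow q hq)
  have hbd : ∀ b : XAnc d, AdjacentRow b q → bd (XAnc.Touches (d := d)) (chi e) b = 0 := by
    intro b hb
    refine sum_eq_zero fun q' _ => ?_
    by_cases hq' : q' ∈ e
    · obtain ⟨j', rfl⟩ := herow q' hq'
      obtain ⟨j, rfl⟩ := herow q hq
      refine if_neg fun ht => ?_
      have h1 : i = b.1 := ht.1
      have h2 : b.1.val + 1 = i.val ∨ b.1.val = i.val + 1 := hb
      rw [h1] at h2; omega
    · simp [chi_eq_zero.2 hq']
  have hwq := weight_of_isolated hd hqm hq hbd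
  rcases h.xWeight_le hcyc Subset.rfl with hz | hw
  · have : L = e := by rw [hL, hz]; exact symmDiff_bot e
    have := congrArg card this
    omega
  · rw [heq] at hw
    have h1 : ((L.filter fun q => q ∉ e).card : ℚ) ≤
        ∑ q ∈ L with q ∉ e, updateWeights (syndrome (toPauli e ∅)) q := by
      rw [card_eq_sum_ones, Nat.cast_sum]
      refine sum_le_sum fun q hq => ?_
      simpa using one_le_weight hd (mem_filter.1 hq).2
    -- The modified qubit contributes `-0.1` and the other `t` errors at most 1 each, while the `t`
    -- non-errors of the row weigh at least `t`.
    have h2 : ∑ q ∈ e, updateWeights (syndrome (toPauli e ∅)) q < t := by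
      rw [← add_sum_erase _ _ hq, hwq]
      have : ∑ q ∈ e.erase q, updateWeights (syndrome (toPauli e ∅)) q ≤ t := by
        calc _ ≤ ∑ q ∈ e.erase q, (1 : ℚ) :=
              sum_le_sum fun q hq => weight_le_one hd (mem_of_mem_erase hq)
          _ = t := by simp [card_erase_of_mem hq, he]
      linarith
    have h3 : (t : ℚ) ≤ (L.filter fun q => q ∉ e).card := by
      exact_mod_cast (by omega : t ≤ (L.filter fun q => q ∉ e).card)
    linarith

end Output

open Finset

section Output

variable {d : ℕ} {e z x : Finset (Qubit d)}

/-! ### The estimate of the `X` errors -/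

lemma cell_lt (hd : 3 < d) (q : Qubit d) : cell q < d := by
  rcases q with ⟨i, j⟩ | ⟨b, c⟩
  · exact i.2
  · have := b.2
    simp only [cell]; omega

lemma card_filter_cell (A : Finset (Qubit d)) (s : Finset ℕ) :
    (A.filter fun q => cell q ∈ s).card = ∑ i ∈ s, (A.filter fun q => cell q = i).card := by
  rw [card_eq_sum_card_fiberwise (f := cell) (t := s) (fun q hq => mem_coe.2 (mem_filter.1 hq).2)]
  refine sum_congr rfl fun i hi => ?_
  rw [filter_filter]
  congr 1
  refine filter_congr fun q _ => ?_
  constructor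
  · exact fun h => h.2
  · rintro rfl; exact ⟨hi, rfl⟩

lemma card_eq_sum_cell (hd : 3 < d) (A : Finset (Qubit d)) :
    A.card = ∑ i ∈ range d, (A.filter fun q => cell q = i).card := by
  rw [← card_filter_cell, filter_true_of_mem]
  exact fun q _ => mem_range.2 (cell_lt hd q)

lemma modCount_le_two (L : Finset (Qubit d)) (i : ℕ) : modCount L i ≤ 2 := by
  refine (card_le_card_of_injOn
    (t := if i % 2 = 0 then {0, d - 1} else {1, d - 2})
    (fun q => Sum.elim (fun p : Fin d × Fin d => p.2.val) (fun _ => 0) q) ?_ ?_).trans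
    (by split_ifs <;> exact card_le_two)
  · rintro (⟨i', j⟩ | q) hq
    · obtain ⟨-, hm, hc⟩ := mem_filter.1 hq
      simp only [Modified, cell] at hm hc
      subst hc
      simp only [Sum.elim_inl]
      split_ifs <;> simp only [coe_insert, coe_singleton, Set.mem_insert_iff,
        Set.mem_singleton_iff] <;> omega
    · exact (mem_filter.1 hq).2.1.elim
  · rintro (⟨i', j⟩ | q) hq (⟨i'', j'⟩ | q') hq' h
    · have h1 := (mem_filter.1 hq).2.2
      have h2 := (mem_filter.1 hq').2.2
      simp only [cell] at h1 h2
      simp only [Sum.elim_inl] at h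
      rw [Fin.ext (h1.trans h2.symm), Fin.ext h]
    · exact (mem_filter.1 hq').2.1.elim
    · exact (mem_filter.1 hq).2.1.elim
    · exact (mem_filter.1 hq).2.1.elim

/-- Each piece of `L` cut out by empty intermediate rows is itself a cycle, so `IsOutput.card_le`
provides the strict inequality required on pieces with modified qubits. -/
lemma IsOutput.modified_rows_bound (hd : 3 < d) (hodd : Odd d)
    (h : IsOutput (syndrome (toPauli e ∅)) z x) :
    ∑ i ∈ range d, (20 * hasMod (modCount (symmDiff e z)) i + modCount (symmDiff e z) i) = 0 ∨
    ∑ i ∈ range d, (20 * hasMod (modCount (symmDiff e z)) i + modCount (symmDiff e z) i) + 11 ≤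
      20 * ((symmDiff e z).filter fun q => q ∈ e).card := by
  have hcyc := h.xCycle
  set L := symmDiff e z with hL
  rw [card_eq_sum_cell hd (L.filter fun q => q ∈ e)]
  refine (isRowProfile hd hodd hcyc).bound (verCount_zero L)
    (u := fun i => ((L.filter fun q => q ∈ e).filter fun q => cell q = i).card)
    (w := fun i => ((L.filter fun q => q ∉ e).filter fun q => cell q = i).card)
    (fun i => ?_) (fun p q hpq hq hp0 hq0 hpos => ?_) d le_rfl (verCount_top L)
  · rw [rowCount_add_verCount, filter_comm _ (fun q => cell q = i), filter_comm _ (fun q => cell q = i)]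
    exact card_filter_add_card_filter_not _
  · obtain ⟨i, hi, hne⟩ := exists_ne_zero_of_sum_ne_zero hpos.ne'
    obtain ⟨y, hy⟩ := card_pos.1 (Nat.pos_of_ne_zero hne)
    obtain ⟨hyL, hym, rfl⟩ := mem_filter.1 hy
    have := (h.card_le hd (hcyc.cut hp0 hq0) (filter_subset _ _)).2
      ⟨y, mem_filter.2 ⟨hyL, hi⟩, hym⟩
    rw [filter_comm _ (fun q => q ∉ e), filter_comm _ (fun q => q ∈ e)] at this
    rwa [card_filter_cell, card_filter_cell] at this

/-- A cycle composed of the estimate of the `X` errors and of a set of modified qubits with the same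
syndrome does not weigh less on the latter. -/
lemma IsOutput.zWeight_le (hd : 3 < d) (h : IsOutput (syndrome (toPauli e ∅)) z x)
    {M N : Finset (Qubit d)} (hM : M = (symmDiff e z).filter Modified) (hN : N = symmDiff x M) :
    N = ∅ ∨ ∑ q ∈ N with q ∉ M, updateWeights (syndrome (toPauli e ∅)) q ≤
      ∑ q ∈ N with q ∈ M, updateWeights (syndrome (toPauli e ∅)) q := by
  have hcyc := zCycle_iff.1 h.zCycle
  rw [← hM, ← hN] at hcyc
  by_cases hS : endpoints (ZAnc.Touches (d := d)) M = ∅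
  · left
    have hx : x = ∅ := by
      have := h.2.1
      rw [switchedOn_flip_eq, ← hM, hS] at this
      exact this.eq_empty
    -- Every modified qubit is detected by a ZY generator that touches no other modified qubit, so a
    -- nonempty `M` has a nonempty boundary.
    have hM0 : M = ∅ := by
      by_contra hne
      obtain ⟨q, hq⟩ := nonempty_iff_ne_empty.2 hne
      have hm : Modified q := by rw [hM] at hq; exact (mem_filter.1 hq).2
      obtain ⟨a, ha⟩ := exists_zAnc_touching hd hm
      have := syndrome_of_measuresY hd M ((measuresY_inr a q).2 ⟨ha, hm⟩)
      rw [syndrome_inr, ← chi_filter_modified, chi_eq_one.2 hq, filter_true_of_mem,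
        ← mem_endpoints, hS] at this
      · exact absurd this (notMem_empty a)
      · intro q' hq'
        rw [hM] at hq'; exact (mem_filter.1 hq').2
    rw [hN, hx, hM0]; exact symmDiff_self _
  · right
    have := h.2.exchange card_zAnc_touching (by rw [switchedOn_flip_eq, ← hM]; exact hS) hcyc
    have h1 : (N.filter fun q => q ∈ x) = N.filter fun q => q ∉ M := by
      refine filter_congr fun q hq => ?_
      rw [hN, mem_symmDiff] at hq; tauto
    have h2 : (N.filter fun q => q ∉ x) = N.filter fun q => q ∈ M := by
      refine filter_congr fun q hq => ?_
      rw [hN, mem_symmDiff] at hq; tauto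
    rwa [h1, h2] at this

/-- A nontrivial `N` needs a qubit in every lattice row, but minimality of `x` requires much of `N`
to lie in `M`, and `M` meets too few rows. -/
lemma IsOutput.rowSum_eq_zero (hd : 3 < d) (hodd : Odd d) {t : ℕ} (hdt : d = 2 * t + 1)
    (he : e.card = t + 1) (h : IsOutput (syndrome (toPauli e ∅)) z x) :
    rowSum (chi (symmDiff x ((symmDiff e z).filter Modified))) 0 = 0 := by
  by_contra hrow
  have hcyc := h.zCycle
  have hbound := h.modified_rows_bound hd hodd
  have hweight := h.zWeight_le hd rfl rfl
  set L := symmDiff e z with hL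
  set M := L.filter Modified with hM
  set N := symmDiff x M with hN
  have hodd_row : ∀ i < d, rowCount N i % 2 = 1 := by
    intro i hi
    rw [← Nat.odd_iff, ← ZMod.natCast_eq_one_iff_odd, rowCount_cast N hi, rowSum_const hcyc hi]
    exact (zmod_two_cases _).resolve_left hrow
  rcases hweight with hN0 | hweight
  · have := hodd_row 0 (by omega)
    simp [hN0, rowCount] at this
  -- Outside `M`, a qubit weighs less than 1 only if it is a modified error also found by `z`. Such
  -- a qubit weighs at least `-1/10`, which costs `11/10` per element of `e ∩ z`; qubits of `M`
  -- weigh at most `11/10`.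
  have hcorrect : (N.filter fun q => q ∉ M).card * 10 ≤
      11 * (N.filter fun q => q ∈ M).card + 11 * (e ∩ z).card := by
    have h1 : ∑ q ∈ N with q ∉ M, ((1 : ℚ) - if q ∈ e ∩ z then 11 / 10 else 0) ≤
        ∑ q ∈ N with q ∉ M, updateWeights (syndrome (toPauli e ∅)) q := by
      refine sum_le_sum fun q hq => ?_
      have hqM := (mem_filter.1 hq).2
      split_ifs with hez
      · have := weight_ge hd (e := e) (q := q)
        linarith
      · rw [sub_zero]
        by_cases hm : Modified q
        · refine one_le_weight hd fun hqe => hqM ?_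
          rw [hM, mem_filter, hL, mem_symmDiff]
          rw [mem_inter] at hez
          tauto
        · rw [weight_of_not_modified hd hm]
    have h2 : ∑ q ∈ N with q ∈ M, updateWeights (syndrome (toPauli e ∅)) q ≤
        11 / 10 * (N.filter fun q => q ∈ M).card := by
      calc _ ≤ ∑ q ∈ N with q ∈ M, (11 / 10 : ℚ) := sum_le_sum fun q _ => weight_le hd
        _ = _ := by rw [sum_const, nsmul_eq_mul, mul_comm]
    have h3 : ∑ q ∈ N with q ∉ M, ((1 : ℚ) - if q ∈ e ∩ z then 11 / 10 else 0) ≥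
        (N.filter fun q => q ∉ M).card - 11 / 10 * (e ∩ z).card := by
      rw [sum_sub_distrib, ← sum_filter, sum_const, sum_const, nsmul_eq_mul, nsmul_eq_mul, mul_one]
      have : ((((N.filter fun q => q ∉ M).filter fun q => q ∈ e ∩ z).card : ℕ) : ℚ) ≤
          (e ∩ z).card := by
        exact_mod_cast card_le_card fun q hq => (mem_filter.1 hq).2
      linarith
    have h4 : ((N.filter fun q => q ∉ M).card : ℚ) * 10 ≤
      11 * (N.filter fun q => q ∈ M).card + 11 * (e ∩ z).card := by linarith
    exact_mod_cast h4
  have hNcard : (N.filter fun q => q ∈ M).card + (N.filter fun q => q ∉ M).card = N.card :=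
    card_filter_add_card_filter_not _
  have hNM : (N.filter fun q => q ∈ M).card =
      ∑ i ∈ range d, ((N.filter fun q => q ∈ M).filter fun q => cell q = i).card :=
    card_eq_sum_cell hd _
  -- With `m ≤ 2` qubits of `N ∩ M` in a row, the oddness of `N` there yields at least 1, 1 or 3
  -- qubits for `m = 0, 1, 2`; the cases `m = 1` and `m = 2` can be tight.
  have hrows : ∑ i ∈ range d, (10 + 21 * ((N.filter fun q => q ∈ M).filter
      fun q => cell q = i).card) ≤
      ∑ i ∈ range d, (10 * (N.filter fun q => cell q = i).card +
        (20 * hasMod (modCount L) i + modCount L i)) := by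
    refine sum_le_sum fun i hi => ?_
    have h1 : ((N.filter fun q => q ∈ M).filter fun q => cell q = i).card ≤ modCount L i := by
      refine card_le_card fun q hq => ?_
      simp only [mem_filter, hM] at hq ⊢
      tauto
    have h2 : ((N.filter fun q => q ∈ M).filter fun q => cell q = i).card ≤ rowCount N i := by
      refine card_le_card fun q hq => ?_
      simp only [mem_filter, hM] at hq ⊢
      exact ⟨hq.1.1, hq.1.2.2.isLeft, hq.2⟩
    have h3 := hodd_row i (mem_range.1 hi)
    have h4 : rowCount N i ≤ (N.filter fun q => cell q = i).card := by
      rw [← rowCount_add_verCount]; omega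
    have h5 := hasMod_cases (modCount L) i
    have h6 := modCount_le_two L i
    omega
  rw [sum_add_distrib, sum_add_distrib, ← mul_sum, ← mul_sum, ← hNM, ← card_eq_sum_cell hd N,
    sum_const, card_range, smul_eq_mul] at hrows
  have hsplit : (L.filter fun q => q ∈ e).card + (e ∩ z).card = t + 1 := by
    rw [← he, ← card_filter_add_card_filter_not (s := e) (fun q => q ∉ z)]
    congr 2
    · ext q; simp only [mem_filter, hL, mem_symmDiff]; tauto
    · ext q; simp only [mem_filter, mem_inter]; tauto
  -- Combining `hrows` with `hcorrect` leaves `10d` at most the sum in `hbound` plus `11 |e ∩ z|`.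
  -- If that sum is nonzero, the right side is at most `20(t+1) - 11 < 20t + 10 = 10d`; if it is
  -- zero, at most `11(t+1)`, again below `10d`.
  omega

end Output

open Finset

/-! ### The failure criterion and the count of uncorrected patterns -/

section Main

variable {d : ℕ} {e z x : Finset (Qubit d)}

/-- The qubits of a lattice row. -/
def latticeRow (i : Fin d) : Finset (Qubit d) :=
  univ.map ⟨fun j : Fin d => Sum.inl (i, j), fun _ _ h => (Prod.mk.inj (Sum.inl.inj h)).2⟩

lemma mem_latticeRow {i : Fin d} {q : Qubit d} :
    q ∈ latticeRow i ↔ ∃ j, q = Sum.inl (i, j) := by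
  simp only [latticeRow, mem_map, mem_univ, true_and]
  exact exists_congr fun j => eq_comm

lemma card_latticeRow (i : Fin d) : (latticeRow i).card = d := by simp [latticeRow]

lemma endpoints_latticeRow (i : Fin d) :
    endpoints (XAnc.Touches (d := d)) (latticeRow i) = ∅ := by
  rw [← xCycle_iff]
  rintro ⟨i', c⟩
  have hc := c.2
  have hhor : ∀ j : ℕ, j < d → hor (chi (latticeRow i)) i' j = if i' = i then 1 else 0 := by
    intro j hj
    rw [hor, dif_pos ⟨i'.2, hj⟩]
    simp [chi, mem_latticeRow]
  have hver : ∀ b c, ver (chi (latticeRow i)) b c = 0 := by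
    intro b c
    simp [ver, chi, mem_latticeRow]
  rw [bdX_eq, hver, hver, hhor _ (by omega), hhor _ (by omega), zmod_two_add_self]
  rfl

lemma colSum_symmDiff (A B : Finset (Qubit d)) (j : ℕ) :
    colSum (chi (symmDiff A B)) j = colSum (chi A) j + colSum (chi B) j := by
  simp only [colSum, chi_symmDiff, hor_add, sum_add_distrib]

lemma colSum_of_row {i j : Fin d} (he : ∀ q ∈ e, ∃ j : Fin d, q = Sum.inl (i, j))
    (hj : Sum.inl (i, j) ∈ e) : colSum (chi e) j = 1 := by
  rw [colSum, sum_range, sum_eq_single i]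
  · rw [hor_fin, chi_eq_one]; exact hj
  · intro i' _ hne
    rw [hor_fin, chi_eq_zero]
    intro hmem
    obtain ⟨j', hj'⟩ := he _ hmem
    exact hne (Prod.mk.inj (Sum.inl.inj hj')).1
  · simp

lemma IsOutput.colSum_ne_zero (hd : 3 < d) {t : ℕ} (hdt : d = 2 * t + 1) (he : e.card = t + 1)
    {i : Fin d} (hrow : ∀ q ∈ e, (∃ j : Fin d, q = Sum.inl (i, j)) ∧ ¬ Modified q)
    (h : IsOutput (syndrome (toPauli e ∅)) z x) : ¬ ∀ j < d, colSum (chi (symmDiff e z)) j = 0 := by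
  intro hcol
  -- Each error is alone in its column within `e`, so even columns of the symmetric difference force
  -- `z` to meet every column that `e` meets.
  have hsub : e.image (Sum.elim Prod.snd fun _ => i) ⊆ z.image (Sum.elim Prod.snd fun _ => i) := by
    intro j hj
    obtain ⟨q, hq, rfl⟩ := mem_image.1 hj
    obtain ⟨j, rfl⟩ := (hrow q hq).1
    have h1 := hcol j j.2
    rw [colSum_symmDiff, colSum_of_row (fun q hq => (hrow q hq).1) hq] at h1
    obtain ⟨i', hi'⟩ := exists_of_colSum j.2 (zmod_two_eq_of_add h1).symm
    exact mem_image.2 ⟨_, hi', rfl⟩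
  have hcard : t + 1 ≤ z.card := by
    rw [← he, ← card_image_of_injOn (s := e) (f := Sum.elim Prod.snd fun _ => i)]
    · exact (card_le_card hsub).trans card_image_le
    · intro q hq q' hq' hqq
      obtain ⟨j, rfl⟩ := (hrow q hq).1
      obtain ⟨j', rfl⟩ := (hrow q' hq').1
      simp only [Sum.elim_inl] at hqq
      rw [hqq]
  have hS : (univ.filter fun a : XAnc d => syndrome (toPauli e ∅) (Sum.inl a) = 1) ≠ ∅ := by
    intro hS
    have := h.1.1
    rw [hS] at this
    rw [this.eq_empty, card_empty] at hcard
    omega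
  have heR : e ⊆ latticeRow i := fun q hq => mem_latticeRow.2 (hrow q hq).1
  have hRe : symmDiff (latticeRow i) e = latticeRow i \ e := by
    ext q; simp only [mem_symmDiff, mem_sdiff]
    have := @heR q; tauto
  have hmin := h.1.le_of_bd card_xAnc_touching hS (E' := latticeRow i \ e) (by
    rw [← hRe, endpoints_symmDiff, endpoints_latticeRow, switchedOn_eq]; exact bot_symmDiff _)
  have hlower : (t + 1 : ℚ) ≤ ∑ q ∈ z, updateWeights (syndrome (toPauli e ∅)) q := by
    calc (t + 1 : ℚ) ≤ ∑ q ∈ z, (1 : ℚ) := by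
          rw [sum_const, nsmul_eq_mul, mul_one]; exact_mod_cast hcard
      _ ≤ _ := sum_le_sum fun q _ => by
          by_cases hq : q ∈ e
          · rw [weight_of_not_modified hd (hrow q hq).2]
          · exact one_le_weight hd hq
  have hR : (latticeRow i \ e).card = t := by
    rw [card_sdiff_of_subset heR, card_latticeRow]; omega
  have hmod : ((latticeRow i \ e).filter Modified).card ≤ 2 := by
    refine (card_le_card ?_).trans (modCount_le_two (latticeRow i) i)
    intro q hq
    rw [mem_filter, mem_sdiff] at hq
    refine mem_filter.2 ⟨hq.1.1, hq.2, ?_⟩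
    obtain ⟨j, rfl⟩ := mem_latticeRow.1 hq.1.1
    rfl
  -- The rest of the row competes with `z`: it has `t` qubits, at most two of them modified, each of
  -- weight at most `11/10`.
  have hupper : ∑ q ∈ latticeRow i \ e, updateWeights (syndrome (toPauli e ∅)) q ≤ t + 2 / 10 := by
    calc _ ≤ ∑ q ∈ latticeRow i \ e, ((1 : ℚ) + if Modified q then 1 / 10 else 0) := by
          refine sum_le_sum fun q _ => ?_
          split_ifs with hm
          · have := weight_le hd (e := e) (q := q)
            linarith
          · rw [weight_of_not_modified hd hm, add_zero]
      _ = t + ((latticeRow i \ e).filter Modified).card * (1 / 10) := by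
          rw [sum_add_distrib, ← sum_filter, sum_const, sum_const, hR, nsmul_eq_mul, nsmul_eq_mul,
            mul_one]
      _ ≤ _ := by
          have : (((latticeRow i \ e).filter Modified).card : ℚ) ≤ 2 := by exact_mod_cast hmod
          linarith
  linarith

theorem not_corrects_iff (hd : 3 < d) (hodd : Odd d) {t : ℕ} (hdt : d = 2 * t + 1)
    (he : e.card = t + 1) {D : Syndrome d → Finset (Qubit d) × Finset (Qubit d)}
    (hD : IsDecoder D) :
    ¬ Corrects D e ↔
      ∃ i : Fin d, ∀ q ∈ e, (∃ j : Fin d, q = Sum.inl (i, j)) ∧ ¬ Modified q := by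
  have hout := hD (syndrome (toPauli e ∅))
  unfold Corrects
  set z := (D (syndrome (toPauli e ∅))).1
  set x := (D (syndrome (toPauli e ∅))).2
  have hprod : toPauli e ∅ + toPauli z x = (chi (symmDiff e z), chi x) := by
    rw [chi_symmDiff]
    refine Prod.ext rfl (funext fun q => ?_)
    simp [toPauli, ind, chi]
  rw [hprod]
  constructor
  · intro h
    by_contra hrow
    apply h
    have hN : (fun q => chi x q + if Modified q then chi (symmDiff e z) q else 0) =
        chi (symmDiff x ((symmDiff e z).filter Modified)) := by
      rw [chi_symmDiff x, chi_filter_modified]; rfl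
    refine mem_stabilizer hout.xCycle (hout.colSum_eq_zero hd hdt he hrow) ?_ ?_
    · rw [hN]; exact hout.zCycle
    · rw [hN]; exact hout.rowSum_eq_zero hd hodd hdt he
  · rintro ⟨i, hrow⟩ hmem
    exact hout.colSum_ne_zero hd hdt he hrow fun j hj => colSum_of_mem_stabilizer hmem hj

/-! ### Counting the uncorrected patterns -/

lemma card_latticeRow_unmodified (hd : 3 < d) (i : Fin d) :
    ((latticeRow i).filter fun q => ¬ Modified q).card = d - 2 := by
  have h : ((latticeRow i).filter fun q => Modified q).card = 2 := by
    have hpair : ∀ a b : Fin d, a ≠ b →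
        (∀ j, Modified (Sum.inl (i, j) : Qubit d) ↔ j = a ∨ j = b) →
        ((latticeRow i).filter fun q => Modified q).card = 2 := by
      intro a b hab hm
      have : (latticeRow i).filter (fun q => Modified q) = {Sum.inl (i, a), Sum.inl (i, b)} := by
        ext q
        simp only [mem_filter, mem_latticeRow, mem_insert, mem_singleton]
        constructor
        · rintro ⟨⟨j, rfl⟩, h⟩
          exact ((hm j).1 h).imp (fun h => by rw [h]) (fun h => by rw [h])
        · rintro (rfl | rfl)
          · exact ⟨⟨a, rfl⟩, (hm a).2 (Or.inl rfl)⟩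
          · exact ⟨⟨b, rfl⟩, (hm b).2 (Or.inr rfl)⟩
      rw [this, card_pair (by simpa using hab)]
    rcases Nat.mod_two_eq_zero_or_one i.val with hi | hi
    · refine hpair ⟨0, by omega⟩ ⟨d - 1, by omega⟩ (by simp; omega) fun j => ?_
      simp only [Modified, Fin.ext_iff]; omega
    · refine hpair ⟨1, by omega⟩ ⟨d - 2, by omega⟩ (by simp; omega) fun j => ?_
      simp only [Modified, Fin.ext_iff]; omega
  have := card_filter_add_card_filter_not (s := latticeRow i) (fun q => Modified q)
  rw [card_latticeRow] at this
  omega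

lemma ncard_patterns (d k : ℕ) :
    {e : Finset (Qubit d) | e.card = k}.ncard = (d ^ 2 + (d - 1) ^ 2).choose k := by
  have : {e : Finset (Qubit d) | e.card = k} = ↑(powersetCard k (univ : Finset (Qubit d))) := by
    ext e; simp [mem_powersetCard]
  rw [this, Set.ncard_coe_finset, card_powersetCard, card_univ]
  simp [sq]

/-- Nonempty patterns determine their row, so the counts of the individual rows add up. -/
lemma ncard_row_patterns (hd : 3 < d) {k : ℕ} (hk : 0 < k) :
    {e : Finset (Qubit d) | e.card = k ∧
      ∃ i : Fin d, ∀ q ∈ e, (∃ j : Fin d, q = Sum.inl (i, j)) ∧ ¬ Modified q}.ncard =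
      d * (d - 2).choose k := by
  have : {e : Finset (Qubit d) | e.card = k ∧
      ∃ i : Fin d, ∀ q ∈ e, (∃ j : Fin d, q = Sum.inl (i, j)) ∧ ¬ Modified q} =
      ↑(univ.biUnion fun i : Fin d =>
        powersetCard k ((latticeRow i).filter fun q => ¬ Modified q)) := by
    ext e
    simp only [Set.mem_ofPred_eq, coe_biUnion, Set.mem_iUnion, mem_coe, mem_univ, exists_prop,
      true_and, mem_powersetCard, subset_iff, mem_filter, mem_latticeRow]
    constructor
    · rintro ⟨h, i, hi⟩; exact ⟨i, fun {q} hq => hi q hq, h⟩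
    · rintro ⟨i, hi, h⟩; exact ⟨h, i, fun q hq => hi hq⟩
  rw [this, Set.ncard_coe_finset, card_biUnion]
  · simp [card_latticeRow_unmodified hd]
  · intro i _ i' _ hne
    refine disjoint_left.2 fun e he he' => ?_
    rw [mem_powersetCard] at he he'
    obtain ⟨q, hq⟩ := card_pos.1 (by rw [he.2]; exact hk)
    obtain ⟨j, rfl⟩ := mem_latticeRow.1 (mem_filter.1 (he.1 hq)).1
    obtain ⟨j', hj'⟩ := mem_latticeRow.1 (mem_filter.1 (he'.1 hq)).1
    exact hne (Prod.mk.inj (Sum.inl.inj hj')).1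

end Main
end ZZZY

theorem lemma1 (d t : ℕ) (hd : 3 < d) (hodd : Odd d) (ht : t = (d - 1) / 2) :
    (∃ D : ZZZY.Syndrome d → Finset (ZZZY.Qubit d) × Finset (ZZZY.Qubit d), ZZZY.IsDecoder D) ∧
    ∀ D : ZZZY.Syndrome d → Finset (ZZZY.Qubit d) × Finset (ZZZY.Qubit d), ZZZY.IsDecoder D →
      (({e : Finset (ZZZY.Qubit d) | e.card = t + 1 ∧ ¬ ZZZY.Corrects D e}.ncard : ℚ) /
          ({e : Finset (ZZZY.Qubit d) | e.card = t + 1}.ncard : ℚ) =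
        (d * (d - 2).choose (t + 1) : ℚ) / ((d ^ 2 + (d - 1) ^ 2).choose (t + 1) : ℚ)) ∧
      ∀ e : Finset (ZZZY.Qubit d), e.card = t + 1 →
        (¬ ZZZY.Corrects D e ↔
          ∃ i : Fin d, ∀ q ∈ e, (∃ j : Fin d, q = Sum.inl (i, j)) ∧
            ¬ ∃ a : ZZZY.Anc d, ZZZY.MeasuresY a q) := by
  have hdt : d = 2 * t + 1 := by
    obtain ⟨m, rfl⟩ := hodd
    omega
  refine ⟨ZZZY.exists_isDecoder, fun D hD => ⟨?_, fun e he => ?_⟩⟩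
  · have hset : {e : Finset (ZZZY.Qubit d) | e.card = t + 1 ∧ ¬ ZZZY.Corrects D e} =
        {e : Finset (ZZZY.Qubit d) | e.card = t + 1 ∧
          ∃ i : Fin d, ∀ q ∈ e, (∃ j : Fin d, q = Sum.inl (i, j)) ∧ ¬ ZZZY.Modified q} :=
      Set.ext fun e => and_congr_right fun he => ZZZY.not_corrects_iff hd hodd hdt he hD
    rw [hset, ZZZY.ncard_row_patterns hd t.succ_pos, ZZZY.ncard_patterns]
    push_cast
    rfl
  · simp only [ZZZY.exists_measuresY_iff hd]
    exact ZZZY.not_corrects_iff hd hodd hdt he hD
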